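/- **Conventions.** An *allocation* of size $n\ge 1$ is a vector $x\in\mathbb R_+^n=[0,\infty)^n$, $x\ne 0$; it is *positive* if all $x_i>0$. Let $p_i=x_i/\sum_j x_j$ be its shares, and $1_n=(1,\dots,1)$. Let $f$ be a family of real-valued functions, one on the allocations of each size $n\ge1$. Let $g:(0,\infty)\to\mathbb R$, and let $s$ be a *weight system*: it assigns to every allocation $y=[y^1,y^2]$ split into two consecutive nonzero blocks a pair $(s_1,s_2)=s(y^1,y^2)$. We say that $f$ *satisfies the axioms with generator $g$ and weights $s$* if 1. (Continuity) $f$ is continuous on the allocations of each size $n\ge 1$. 2. (Homogeneity) $f(tx)=f(x)$ for all $t>0$; and $|f(x_1)|=1$ for $n=1$, $x_1>0$. 3. (Boundedness) $f(1_{n+1})/f(1_n)\to 1$ as $n\to\infty$. 4. (Partition) $g$ is continuous and strictly monotonic; $s_1,s_2>0$, $s_1+s_2=1$ always; $f(x)\neq0$ for positive $x$; and for all allocations $x=[x^1,x^2]$, $y=[y^1,y^2]$, split into nonzero blocks (of arbitrary lengths) with $\sum_j x^i_j=\sum_j y^i_j$ for $i=1,2$, and such that none of the values $f(x),f(y),f(x^i),f(y^i)$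 is $0$, all the following ratios are positive and $$\frac{f(x)}{f(y)}=g^{-1}\Big(s_1\,g\Big(\frac{f(x^1)}{f(y^1)}\Big)+s_2\,g\Big(\frac{f(x^2)}{f(y^2)}\Big)\Big),\qquad (s_1,s_2)=s(y^1,y^2).$$ 5. (Increasing fairness) $f(1,0)\le f(\tfrac12,\tfrac12)$. $f$ is a *fairness measure* if it satisfies the axioms with some $g$ and $s$. The weights $s$ are *power weights with exponent $\rho\in\mathbb R$* if, whenever $y^1=(w_1)$ and $y^2=(w_2)$ are single positive entries, $s_i=w_i^\rho/(w_1^\rho+w_2^\rho)$. Two generators are *equivalent* if $g=a h+b$ on $(0,\infty)$ for constants $a\neq0$, $b$. For $\sigma\in\{1,-1\}$ consider * the **logarithmic form** $f(x)=\sigma\prod_{i=1}^n p_i^{\,r p_i}$, $r\in\mathbb R$ (with $0^0=1$), *admissible* if $\sigma=-\operatorname{sign} r$ or $r=0$; * the **power form** $f(x)=\sigma\big(\sum_{i=1}^n p_i^{1-\beta r}\big)^{1/\beta}$, $\beta\ne0$, $r\in\mathbb R$ (with $0^0=1$, and with value $0$ if $1-\beta r<0$ and some $p_i=0$), *admissible*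 if ($1-\beta r\ge 0$ or $\beta<0$), and ($\sigma=\operatorname{sign}(r(1-\beta r))$ or $r(1-\beta r)=0$). **Theorem (Existence, Uniqueness, and Construction of Fairness Measures).** *Existence.* Fairness measures exist. Every admissible logarithmic form satisfies the axioms with generator $g=\log$ and some power weights of exponent $1$, and every admissible power form satisfies them with generator $g(y)=y^\beta$ and some power weights of exponent $1-\beta r$. *Uniqueness.* If $f$ satisfies the axioms with generator $g$ and some weights, and $f$ is not one and the same constant for all allocations of all sizes, then $g$ is equivalent to $\log y$ or to $y^\beta$ for some $\beta\ne 0$. *Construction.* If $f$ satisfies the axioms with generator $g$ and power weights of exponent $\rho$, then $f$ is an admissible logarithmic form, where if $r\ne0$ then $g$ is equivalent to $\log$ and $\rho=1$; or $f$ is an admissible power form, where if $r\neq0$ then $g$ is equivalent to $y^\beta$ and $\rho=1-\beta r$. *Atkinson index.* For $\beta\neq0$, $\varepsilon=\beta r\ne1$ and every positive $x$ of size $n$, $$\Big(\sum_{i=1}^n p_i^{1-\beta r}\Big)^{1/\beta}=n^{r}\,\bigl(1-A_\varepsilon(x)\bigr)^{(1-\varepsilon)/\beta},\qquad A_\varepsilon(x)=1-\frac{\big(\frac1n\sum_i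 x_i^{1-\varepsilon}\big)^{1/(1-\varepsilon)}}{\frac1n\sum_i x_i}.$$ -/

import Mathlib

open Set Filter Topology

/-- Resource allocations for `n` users: the nonnegative orthant without the zero vector. -/
def Alloc (n : ℕ) : Set (Fin n → ℝ) := {x | (∀ i, 0 ≤ x i) ∧ x ≠ 0}

/-- A system of weights. `s m₁ m₂ y₁ y₂ = (s₁, s₂)` are the weights of the two blocks of a
reference allocation `y = [y₁, y₂]` with blocks of lengths `m₁` and `m₂`. -/
abbrev WeightSystem : Type :=
  (m₁ m₂ : ℕ) → (Fin m₁ → ℝ) → (Fin m₂ → ℝ) → ℝ × ℝ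

/-- The five fairness axioms for the family `f = (f n)`, with partition generator `g` and
partition weights `s`. Only values of `f n`, `n ≥ 1`, on `Alloc n` and of `g` on `(0, ∞)` matter. -/
structure FairnessAxioms (f : (n : ℕ) → (Fin n → ℝ) → ℝ) (g : ℝ → ℝ) (s : WeightSystem) :
    Prop where
  /-- Continuity. -/
  continuity : ∀ n, 1 ≤ n → ContinuousOn (f n) (Alloc n)
  /-- Homogeneity of degree `0`. -/
  homogeneity : ∀ n, 1 ≤ n → ∀ x ∈ Alloc n, ∀ t : ℝ, 0 < t → f n x = f n (t • x)
  /-- Normalization for a single user. -/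
  single : ∀ x : Fin 1 → ℝ, 0 < x 0 → |f 1 x| = 1
  /-- Boundedness, for the equal allocations `1_n = (1, …, 1)`. -/
  boundedness : Tendsto (fun n : ℕ => f (n + 1) (fun _ => 1) / f n (fun _ => 1)) atTop (𝓝 1)
  /-- The generator is continuous and strictly monotonic on `(0, ∞)`. -/
  generator_continuous : ContinuousOn g (Ioi 0)
  generator_monotonic : StrictMonoOn g (Ioi 0) ∨ StrictAntiOn g (Ioi 0)
  /-- The weights are positive and sum to one. -/
  weights : ∀ m₁ m₂ : ℕ, ∀ y₁ ∈ Alloc m₁, ∀ y₂ ∈ Alloc m₂,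
    0 < (s m₁ m₂ y₁ y₂).1 ∧ 0 < (s m₁ m₂ y₁ y₂).2 ∧
      (s m₁ m₂ y₁ y₂).1 + (s m₁ m₂ y₁ y₂).2 = 1
  /-- Fairness ratios of strictly positive allocations are defined. -/
  nonvanishing : ∀ n, 1 ≤ n → ∀ x : Fin n → ℝ, (∀ i, 0 < x i) → f n x ≠ 0
  /-- Partition. Whenever no fairness value involved vanishes, the fairness ratios lie in the
  domain `(0, ∞)` of `g`, and the ratio `f(x) / f(y)` is
  `g⁻¹ (s₁ * g (f(x₁) / f(y₁)) + s₂ * g (f(x₂) / f(y₂)))`. Corresponding blocks have the same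
  total; they need not have the same length. -/
  partition : ∀ n₁ n₂ m₁ m₂ : ℕ, ∀ x₁ ∈ Alloc n₁, ∀ x₂ ∈ Alloc n₂,
    ∀ y₁ ∈ Alloc m₁, ∀ y₂ ∈ Alloc m₂,
    ∑ j, x₁ j = ∑ j, y₁ j → ∑ j, x₂ j = ∑ j, y₂ j →
    f n₁ x₁ ≠ 0 → f n₂ x₂ ≠ 0 → f m₁ y₁ ≠ 0 → f m₂ y₂ ≠ 0 →
    f (n₁ + n₂) (Fin.append x₁ x₂) ≠ 0 → f (m₁ + m₂) (Fin.append y₁ y₂) ≠ 0 →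
    0 < f n₁ x₁ / f m₁ y₁ ∧ 0 < f n₂ x₂ / f m₂ y₂ ∧
    0 < f (n₁ + n₂) (Fin.append x₁ x₂) / f (m₁ + m₂) (Fin.append y₁ y₂) ∧
    g (f (n₁ + n₂) (Fin.append x₁ x₂) / f (m₁ + m₂) (Fin.append y₁ y₂)) =
      (s m₁ m₂ y₁ y₂).1 * g (f n₁ x₁ / f m₁ y₁) + (s m₁ m₂ y₁ y₂).2 * g (f n₂ x₂ / f m₂ y₂)
  /-- Increasing fairness: starvation is no fairer than equal allocation. -/
  increasing : f 2 ![1, 0] ≤ f 2 ![1 / 2, 1 / 2]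

/-- `f` is a fairness measure: it satisfies the axioms for some generator and some weights. -/
def IsFairnessMeasure (f : (n : ℕ) → (Fin n → ℝ) → ℝ) : Prop :=
  ∃ (g : ℝ → ℝ) (s : WeightSystem), FairnessAxioms f g s

/-- Power weights with exponent `ρ`: relative to the allocation whose two blocks are single users
holding `w₁` and `w₂`, the weights are `sᵢ = wᵢ ^ ρ / (w₁ ^ ρ + w₂ ^ ρ)`. -/
def HasPowerWeights (s : WeightSystem) (ρ : ℝ) : Prop :=
  ∀ w₁ w₂ : ℝ, 0 < w₁ → 0 < w₂ →
    s 1 1 (fun _ => w₁) (fun _ => w₂) =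
      (w₁ ^ ρ / (w₁ ^ ρ + w₂ ^ ρ), w₂ ^ ρ / (w₁ ^ ρ + w₂ ^ ρ))

/-- `g` and `h` agree on `(0, ∞)` up to a nonconstant affine change of values; such generators
define the same means `g⁻¹ (∑ sᵢ g (·))`. -/
def GeneratorEquiv (g h : ℝ → ℝ) : Prop :=
  ∃ a b : ℝ, a ≠ 0 ∧ ∀ y : ℝ, 0 < y → g y = a * h y + b

/-- The share `xᵢ / ∑ⱼ xⱼ` of user `i`. -/
noncomputable def share {n : ℕ} (x : Fin n → ℝ) (i : Fin n) : ℝ := x i / ∑ j, x j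

/-- The unsigned logarithmic form `∏ᵢ pᵢ ^ (r pᵢ)` in the shares `pᵢ`, with `0 ^ 0 = 1`. -/
noncomputable def logForm (r : ℝ) {n : ℕ} (x : Fin n → ℝ) : ℝ :=
  ∏ i, share x i ^ (r * share x i)

/-- The unsigned power form `(∑ᵢ pᵢ ^ (1 - β r)) ^ (1 / β)` in the shares `pᵢ`. If `1 - β r < 0`
and some share is `0`, then the sum is infinite, and the value is `0`, which is the limit from
positive shares for `β < 0`. (For `1 - β r = 0` the convention is `0 ^ 0 = 1`.) -/
noncomputable def powerForm (β r : ℝ) {n : ℕ} (x : Fin n → ℝ) : ℝ :=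
  open Classical in
  if 1 - β * r < 0 ∧ ∃ i, x i = 0 then 0
  else (∑ i, share x i ^ (1 - β * r)) ^ (1 / β)

/-- The Atkinson index `1 - y_e / μ`, where `μ` is the mean and
`y_e = (n⁻¹ ∑ᵢ xᵢ ^ (1 - ε)) ^ (1 / (1 - ε))`, for `ε ≠ 1`. -/
noncomputable def atkinsonIndex (ε : ℝ) {n : ℕ} (x : Fin n → ℝ) : ℝ :=
  1 - ((∑ i, x i ^ (1 - ε)) / n) ^ (1 / (1 - ε)) / ((∑ i, x i) / n)

/-- Parameters of the logarithmic form: a sign `σ = ±1` which is `- sign r` unless `r = 0`. -/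
def LogAdmissible (σ r : ℝ) : Prop := (σ = 1 ∨ σ = -1) ∧ 0 ≤ σ * (-r)

/-- Parameters of the power form: `β ≠ 0`, the form extends continuously and with real values to
allocations with zero entries, and the sign `σ = ±1` is `sign (r (1 - β r))` unless this is `0`. -/
def PowerAdmissible (σ β r : ℝ) : Prop :=
  (σ = 1 ∨ σ = -1) ∧ β ≠ 0 ∧ (0 ≤ 1 - β * r ∨ β < 0) ∧ 0 ≤ σ * (r * (1 - β * r))

/-! Existence is a computation: once block totals are fixed, `log f` for the logarithmic form and `f
^ β` for the power form depend on the entries through one sum over them, and such a sum splits over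
blocks.

For the converse, normalize `f` by its sign and restrict it to lists of positive reals. Replacing
every entry by a block with the same total and fairness `C` multiplies the fairness by `C`, because
all ratios agree and the weights drop out (`ListFairness.flatMap`). Hence `n ↦ f(1_n)` is completely
multiplicative, and boundedness makes it `n ^ r` (`exists_rpow_of_multiplicative`). If `r = 0`,
splitting integers into ones shows that `f` is constant on positive integer allocations, hence
everywhere by homogeneity, continuity and density.

If `r ≠ 0`, comparing two blocks cut into `n` and `m` equal parts with blocks cut into `k` parts
yields a weighted mean for `P t = g (exp (r t))` at `log (n/k)`, `log (m/k)`. Its weights do not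
depend on `k`, and cutting every part further translates the arguments. The mean is therefore
translation invariant on a dense set, hence everywhere. Two functions with the same mean are
affinely related (`affine_of_mean`), so translates of `P` are affine in `P`, and `P` is affine or
exponential (`affine_or_exp_of_translates`). In the variable `y = exp (r t)` these are `log y` and
`y ^ β`.

Power weights turn partition into a merging rule for two blocks. Applied to blocks of ones it
determines two-user values; bracketing `(2, 1, 1)` in two ways then forces the exponent, and
induction on the length gives the formula on integer lists. Continuity at `(1, 0)` and increasing
fairness yield admissibility. -/

/-! ### Allocations and shares. -/

lemma alloc_sum_pos {n : ℕ} {x : Fin n → ℝ} (hx : x ∈ Alloc n) : 0 < ∑ i, x i := by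
  obtain ⟨i, hi⟩ := Function.ne_iff.1 hx.2
  exact Finset.sum_pos' (fun i _ => hx.1 i) ⟨i, Finset.mem_univ i, (hx.1 i).lt_of_ne' hi⟩

lemma mem_alloc_of_pos {n : ℕ} (hn : 1 ≤ n) {x : Fin n → ℝ} (hx : ∀ i, 0 < x i) :
    x ∈ Alloc n :=
  ⟨fun i => (hx i).le, fun h => (hx ⟨0, hn⟩).ne' (congrFun h _)⟩

lemma alloc_append {m n : ℕ} {x : Fin m → ℝ} {y : Fin n → ℝ} (hx : x ∈ Alloc m)
    (hy : y ∈ Alloc n) : Fin.append x y ∈ Alloc (m + n) := by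
  refine ⟨fun i => ?_, fun h => hx.2 ?_⟩
  · refine Fin.addCases (fun i => ?_) (fun i => ?_) i
    · simpa using hx.1 i
    · simpa using hy.1 i
  · ext i
    simpa using congrFun h (Fin.castAdd n i)

lemma sum_append {m n : ℕ} (x : Fin m → ℝ) (y : Fin n → ℝ) (φ : ℝ → ℝ) :
    ∑ i, φ (Fin.append x y i) = ∑ i, φ (x i) + ∑ i, φ (y i) := by
  simp [Fin.sum_univ_add]

lemma share_nonneg {n : ℕ} {x : Fin n → ℝ} (hx : x ∈ Alloc n) (i : Fin n) : 0 ≤ share x i :=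
  div_nonneg (hx.1 i) (alloc_sum_pos hx).le

lemma share_smul {n : ℕ} (x : Fin n → ℝ) {t : ℝ} (ht : 0 < t) (i : Fin n) :
    share (t • x) i = share x i := by
  simp only [share, Pi.smul_apply, smul_eq_mul, ← Finset.mul_sum]
  exact mul_div_mul_left _ _ ht.ne'

lemma continuousOn_share {n : ℕ} (i : Fin n) :
    ContinuousOn (fun x : Fin n → ℝ => share x i) (Alloc n) := by
  unfold share
  refine ContinuousOn.div (by fun_prop) (by fun_prop) fun x hx => (alloc_sum_pos hx).ne'

lemma share_single (x : Fin 1 → ℝ) (hx : 0 < x 0) : share x 0 = 1 := by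
  simp [share, hx.ne']

lemma share_one (n : ℕ) (i : Fin n) : share (fun _ : Fin n => (1 : ℝ)) i = (n : ℝ)⁻¹ := by
  simp [share]

/-! ### The logarithmic form -/

lemma logForm_eq_exp {n : ℕ} (r : ℝ) {x : Fin n → ℝ} (hx : x ∈ Alloc n) :
    logForm r x = Real.exp (r * ∑ i, share x i * Real.log (share x i)) := by
  rw [Finset.mul_sum, Real.exp_sum, logForm]
  refine Finset.prod_congr rfl fun i _ => ?_
  rcases (share_nonneg hx i).eq_or_lt with h | h
  · simp [← h]
  · rw [Real.rpow_def_of_pos h]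
    ring_nf

lemma logForm_pos {n : ℕ} (r : ℝ) {x : Fin n → ℝ} (hx : x ∈ Alloc n) : 0 < logForm r x := by
  rw [logForm_eq_exp r hx]
  exact Real.exp_pos _

/-- In terms of the entries instead of the shares, the only quantities left are two sums, both
additive under concatenation; this is what makes the partition identity linear. -/
lemma log_logForm {n : ℕ} (r : ℝ) {x : Fin n → ℝ} (hx : x ∈ Alloc n) :
    Real.log (logForm r x) =
      r * ((∑ i, x i * Real.log (x i)) / (∑ i, x i) - Real.log (∑ i, x i)) := by
  have hT := alloc_sum_pos hx
  rw [logForm_eq_exp r hx, Real.log_exp]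
  congr 1
  set T := ∑ i, x i with hTdef
  have : ∀ i, share x i * Real.log (share x i) =
      (x i * Real.log (x i)) / T - x i / T * Real.log T := by
    intro i
    unfold share
    rw [← hTdef]
    rcases (hx.1 i).eq_or_lt with h | h
    · simp [← h]
    · rw [Real.log_div h.ne' hT.ne']
      ring
  rw [Finset.sum_congr rfl fun i _ => this i, Finset.sum_sub_distrib, ← Finset.sum_div,
    ← Finset.sum_mul, ← Finset.sum_div, ← hTdef, div_self hT.ne', one_mul]

lemma logForm_smul {n : ℕ} (r : ℝ) (x : Fin n → ℝ) {t : ℝ} (ht : 0 < t) :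
    logForm r (t • x) = logForm r x := by
  simp only [logForm, share_smul x ht]

lemma continuousOn_logForm (r : ℝ) (n : ℕ) :
    ContinuousOn (fun x : Fin n → ℝ => logForm r x) (Alloc n) := by
  have : ContinuousOn (fun x : Fin n → ℝ =>
      Real.exp (r * ∑ i, share x i * Real.log (share x i))) (Alloc n) := by
    refine Real.continuous_exp.comp_continuousOn (continuousOn_const.mul ?_)
    exact continuousOn_finsetSum _ fun i _ =>
      Real.continuous_mul_log.comp_continuousOn (continuousOn_share i)
  exact this.congr fun x hx => logForm_eq_exp r hx

lemma logForm_one (r : ℝ) {n : ℕ} (hn : 1 ≤ n) :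
    logForm r (fun _ : Fin n => (1 : ℝ)) = (n : ℝ) ^ (-r) := by
  have hn' : (0 : ℝ) < n := by exact_mod_cast hn
  simp only [logForm, share_one, Finset.prod_const, Finset.card_univ, Fintype.card_fin]
  rw [← Real.rpow_natCast, ← Real.rpow_mul (by positivity), Real.inv_rpow hn'.le,
    ← Real.rpow_neg hn'.le]
  congr 1
  field_simp

lemma tendsto_succ_div_rpow (r : ℝ) :
    Tendsto (fun n : ℕ => ((n + 1 : ℕ) : ℝ) ^ r / (n : ℝ) ^ r) atTop (𝓝 1) := by
  have h1 : Tendsto (fun n : ℕ => ((n : ℝ) + 1) / n) atTop (𝓝 1) := by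
    have := tendsto_one_div_atTop_nhds_zero_nat (𝕜 := ℝ)
    have h2 := this.const_add 1
    rw [add_zero] at h2
    refine h2.congr' ?_
    filter_upwards [eventually_gt_atTop 0] with n hn
    have : (0 : ℝ) < n := by exact_mod_cast hn
    field_simp
  have h2 := h1.rpow_const (p := r) (Or.inl one_ne_zero)
  rw [Real.one_rpow] at h2
  refine h2.congr fun n => ?_
  push_cast
  rw [Real.div_rpow (by positivity) (by positivity)]

lemma mul_div_mul_sign {σ : ℝ} (hσ : σ = 1 ∨ σ = -1) (a b : ℝ) : σ * a / (σ * b) = a / b :=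
  mul_div_mul_left _ _ (by rcases hσ with rfl | rfl <;> norm_num)

lemma logForm_half (r : ℝ) : logForm r ![(1 : ℝ) / 2, 1 / 2] = 2 ^ (-r) := by
  rw [show ![(1 : ℝ) / 2, 1 / 2] = (1 / 2 : ℝ) • (fun _ : Fin 2 => (1 : ℝ)) by
    ext i; fin_cases i <;> simp, logForm_smul _ _ (by norm_num), logForm_one _ (by norm_num)]
  norm_num

lemma logForm_starved (r : ℝ) : logForm r ![(1 : ℝ), 0] = 1 := by
  simp [logForm, share, Fin.prod_univ_two, Fin.sum_univ_two]

/-- The comparison is between `1` and `2 ^ (-r)`. The equivalence serves both directions: existence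
needs one implication, construction the other. -/
lemma logAdmissible_increasing_iff {σ r : ℝ} (hσ : σ = 1 ∨ σ = -1) :
    0 ≤ σ * (-r) ↔ σ * logForm r ![(1 : ℝ), 0] ≤ σ * logForm r ![(1 : ℝ) / 2, 1 / 2] := by
  rw [logForm_half, logForm_starved]
  rcases hσ with rfl | rfl
  · rw [one_mul, one_mul, one_mul]
    constructor
    · exact fun h => Real.one_le_rpow one_le_two h
    · intro h
      by_contra! h'
      exact absurd (Real.rpow_lt_one_of_one_lt_of_neg one_lt_two h') (not_lt.2 h)
  · constructor
    · intro h
      have := Real.rpow_le_one_of_one_le_of_nonpos (x := (2 : ℝ)) (z := -r) one_le_two (by linarith)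
      linarith
    · intro h
      by_contra! h'
      have := Real.one_lt_rpow (x := (2 : ℝ)) (z := -r) one_lt_two (by linarith)
      linarith

lemma logForm_partition (r : ℝ) {n₁ n₂ m₁ m₂ : ℕ} {x₁ : Fin n₁ → ℝ} {x₂ : Fin n₂ → ℝ}
    {y₁ : Fin m₁ → ℝ} {y₂ : Fin m₂ → ℝ} (hx₁ : x₁ ∈ Alloc n₁) (hx₂ : x₂ ∈ Alloc n₂)
    (hy₁ : y₁ ∈ Alloc m₁) (hy₂ : y₂ ∈ Alloc m₂) (h₁ : ∑ j, x₁ j = ∑ j, y₁ j)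
    (h₂ : ∑ j, x₂ j = ∑ j, y₂ j) :
    Real.log (logForm r (Fin.append x₁ x₂) / logForm r (Fin.append y₁ y₂)) =
      (∑ j, y₁ j) / (∑ j, y₁ j + ∑ j, y₂ j) * Real.log (logForm r x₁ / logForm r y₁) +
      (∑ j, y₂ j) / (∑ j, y₁ j + ∑ j, y₂ j) * Real.log (logForm r x₂ / logForm r y₂) := by
  have hx := alloc_append hx₁ hx₂
  have hy := alloc_append hy₁ hy₂
  rw [Real.log_div (logForm_pos r hx).ne' (logForm_pos r hy).ne',
    Real.log_div (logForm_pos r hx₁).ne' (logForm_pos r hy₁).ne',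
    Real.log_div (logForm_pos r hx₂).ne' (logForm_pos r hy₂).ne', log_logForm r hx,
    log_logForm r hy, log_logForm r hx₁, log_logForm r hx₂, log_logForm r hy₁, log_logForm r hy₂,
    sum_append x₁ x₂ (fun t => t), sum_append y₁ y₂ (fun t => t),
    sum_append x₁ x₂ (fun t => t * Real.log t), sum_append y₁ y₂ (fun t => t * Real.log t), h₁, h₂]
  have := alloc_sum_pos hy₁
  have := alloc_sum_pos hy₂
  field_simp
  ring

theorem fairnessAxioms_logForm {σ r : ℝ} (h : LogAdmissible σ r) :
    ∃ s : WeightSystem, HasPowerWeights s 1 ∧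
      FairnessAxioms (fun _ x => σ * logForm r x) Real.log s := by
  obtain ⟨hσ, hr⟩ := h
  have hσ0 : σ ≠ 0 := by rcases hσ with rfl | rfl <;> norm_num
  refine ⟨fun m₁ m₂ y₁ y₂ => ((∑ j, y₁ j) / (∑ j, y₁ j + ∑ j, y₂ j),
    (∑ j, y₂ j) / (∑ j, y₁ j + ∑ j, y₂ j)), fun w₁ w₂ _ _ => by simp, ?_⟩
  constructor
  · exact fun n _ => continuousOn_const.mul (continuousOn_logForm r n)
  · intro n _ x _ t ht
    simp only [logForm_smul r x ht]
  · intro x hx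
    have : logForm r x = 1 := by simp [logForm, share_single x hx]
    rcases hσ with rfl | rfl <;> simp [this]
  · refine (tendsto_succ_div_rpow (-r)).congr' ?_
    filter_upwards [eventually_ge_atTop 1] with n hn
    rw [mul_div_mul_sign hσ, logForm_one r hn, logForm_one r (by omega)]
  · exact Real.continuousOn_log.mono fun y hy => ne_of_gt hy
  · exact Or.inl Real.strictMonoOn_log
  · intro m₁ m₂ y₁ hy₁ y₂ hy₂
    have h₁ := alloc_sum_pos hy₁
    have h₂ := alloc_sum_pos hy₂
    refine ⟨by positivity, by positivity, ?_⟩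
    field_simp
  · exact fun n hn x hx => mul_ne_zero hσ0 (logForm_pos r (mem_alloc_of_pos hn hx)).ne'
  · intro n₁ n₂ m₁ m₂ x₁ hx₁ x₂ hx₂ y₁ hy₁ y₂ hy₂ h₁ h₂ _ _ _ _ _ _
    simp only [mul_div_mul_sign hσ]
    exact ⟨div_pos (logForm_pos r hx₁) (logForm_pos r hy₁),
      div_pos (logForm_pos r hx₂) (logForm_pos r hy₂),
      div_pos (logForm_pos r (alloc_append hx₁ hx₂)) (logForm_pos r (alloc_append hy₁ hy₂)),
      logForm_partition r hx₁ hx₂ hy₁ hy₂ h₁ h₂⟩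
  · exact (logAdmissible_increasing_iff hσ).1 hr

/-! ### The power form -/

/-- Zero entries are harmless for every `q`, since `Real.rpow` gives `0 ^ q ≥ 0` even for `q < 0`.
Weights built from these sums are thus positive on all allocations. -/
lemma rpow_nonneg_sum_pos {n : ℕ} (q : ℝ) {x : Fin n → ℝ} (hx : x ∈ Alloc n) :
    0 < ∑ i, x i ^ q := by
  obtain ⟨i, hi⟩ := Function.ne_iff.1 hx.2
  exact Finset.sum_pos' (fun i _ => Real.rpow_nonneg (hx.1 i) _)
    ⟨i, Finset.mem_univ i, Real.rpow_pos_of_pos ((hx.1 i).lt_of_ne' hi) _⟩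

lemma sum_share_rpow {n : ℕ} (q : ℝ) {x : Fin n → ℝ} (hx : x ∈ Alloc n) :
    ∑ i, share x i ^ q = (∑ i, x i ^ q) / (∑ i, x i) ^ q := by
  rw [Finset.sum_div]
  exact Finset.sum_congr rfl fun i _ => Real.div_rpow (hx.1 i) (alloc_sum_pos hx).le _

lemma sum_share_rpow_pos {n : ℕ} (q : ℝ) {x : Fin n → ℝ} (hx : x ∈ Alloc n) :
    0 < ∑ i, share x i ^ q := by
  rw [sum_share_rpow q hx]
  exact div_pos (rpow_nonneg_sum_pos q hx) (Real.rpow_pos_of_pos (alloc_sum_pos hx) _)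

lemma powerForm_of_not {n : ℕ} {β r : ℝ} {x : Fin n → ℝ}
    (h : ¬ (1 - β * r < 0 ∧ ∃ i, x i = 0)) :
    powerForm β r x = (∑ i, share x i ^ (1 - β * r)) ^ (1 / β) := by
  rw [powerForm, if_neg h]

lemma powerForm_of_pos {n : ℕ} (β r : ℝ) {x : Fin n → ℝ} (hx : ∀ i, 0 < x i) :
    powerForm β r x = (∑ i, share x i ^ (1 - β * r)) ^ (1 / β) :=
  powerForm_of_not fun h => by
    obtain ⟨i, hi⟩ := h.2
    exact (hx i).ne' hi

lemma powerForm_nonneg {n : ℕ} (β r : ℝ) {x : Fin n → ℝ} (hx : x ∈ Alloc n) :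
    0 ≤ powerForm β r x := by
  unfold powerForm
  split_ifs
  · exact le_rfl
  · exact Real.rpow_nonneg (sum_share_rpow_pos _ hx).le _

lemma powerForm_pos {n : ℕ} (β r : ℝ) {x : Fin n → ℝ} (hx : x ∈ Alloc n)
    (h : powerForm β r x ≠ 0) : 0 < powerForm β r x :=
  (powerForm_nonneg β r hx).lt_of_ne' h

/-- A nonzero value excludes the conventional branch of the definition, so the sum formula applies
even when some entries vanish. -/
lemma powerForm_rpow {n : ℕ} {β r : ℝ} (hβ : β ≠ 0) {x : Fin n → ℝ} (hx : x ∈ Alloc n)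
    (h : powerForm β r x ≠ 0) :
    powerForm β r x ^ β = (∑ i, x i ^ (1 - β * r)) / (∑ i, x i) ^ (1 - β * r) := by
  rw [powerForm_of_not fun h' => h (by rw [powerForm, if_pos h']),
    ← Real.rpow_mul (sum_share_rpow_pos _ hx).le, one_div_mul_cancel hβ, Real.rpow_one,
    sum_share_rpow _ hx]

lemma powerForm_smul {n : ℕ} (β r : ℝ) (x : Fin n → ℝ) {t : ℝ} (ht : 0 < t) :
    powerForm β r (t • x) = powerForm β r x := by
  simp only [powerForm, share_smul x ht, Pi.smul_apply, smul_eq_mul, mul_eq_zero, ht.ne', false_or]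

lemma continuousWithinAt_share_rpow_sum {n : ℕ} {q b : ℝ} {x : Fin n → ℝ} (hx : x ∈ Alloc n)
    (h : 0 ≤ q ∨ ∀ i, 0 < x i) :
    ContinuousWithinAt (fun x : Fin n → ℝ => (∑ i, share x i ^ q) ^ b) (Alloc n) x := by
  refine ContinuousWithinAt.rpow_const ?_ (Or.inl (sum_share_rpow_pos q hx).ne')
  refine tendsto_finsetSum _ fun i _ => ?_
  refine ContinuousWithinAt.rpow_const (continuousOn_share i x hx) ?_
  rcases h with h | h
  · exact Or.inr h
  · exact Or.inl (div_pos (h i) (alloc_sum_pos hx)).ne'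

lemma continuousOn_powerForm {β r : ℝ} (h : 0 ≤ 1 - β * r ∨ β < 0) (n : ℕ) :
    ContinuousOn (fun x : Fin n → ℝ => powerForm β r x) (Alloc n) := by
  rcases le_or_gt 0 (1 - β * r) with hq | hq
  · intro x hx
    refine (continuousWithinAt_share_rpow_sum (b := 1 / β) hx (Or.inl hq)).congr ?_ ?_
    · exact fun y _ => powerForm_of_not fun h' => absurd h'.1 (not_lt.2 hq)
    · exact powerForm_of_not fun h' => absurd h'.1 (not_lt.2 hq)
  · have hβ' : β < 0 := h.resolve_left (not_le.2 hq)
    intro x hx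
    by_cases hpos : ∀ i, 0 < x i
    · refine (continuousWithinAt_share_rpow_sum (b := 1 / β) hx (Or.inr hpos)).congr_of_eventuallyEq
        ?_ (powerForm_of_pos β r hpos)
      have : ∀ᶠ y in 𝓝 x, ∀ i, 0 < y i := by
        rw [eventually_all]
        exact fun i => (continuous_apply i).continuousAt.eventually_const_lt (hpos i)
      filter_upwards [mem_nhdsWithin_of_mem_nhds this] with y hy
      exact powerForm_of_pos β r hy
    · push Not at hpos
      obtain ⟨i, hi⟩ := hpos
      have hi : x i = 0 := le_antisymm hi (hx.1 i)
      have hp : 0 < (1 - β * r) * (1 / β) :=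
        mul_pos_of_neg_of_neg hq (one_div_neg.2 hβ')
      have h0 : powerForm β r x = 0 := by rw [powerForm, if_pos ⟨hq, i, hi⟩]
      -- Squeeze at the boundary: the sum of powers dominates its `i`-th term and `1 / β < 0`, so
      -- the form is at most this power of the `i`-th share, whose exponent is positive.
      have hlim : Tendsto (fun y : Fin n → ℝ => share y i ^ ((1 - β * r) * (1 / β)))
          (𝓝[Alloc n] x) (𝓝 0) := by
        have := (continuousOn_share i x hx).rpow_const (p := (1 - β * r) * (1 / β))
          (Or.inr hp.le)
        simp only [ContinuousWithinAt] at this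
        rwa [show share x i = 0 by simp [share, hi], Real.zero_rpow hp.ne'] at this
      simp only [ContinuousWithinAt]
      rw [h0]
      refine tendsto_of_tendsto_of_tendsto_of_le_of_le' tendsto_const_nhds hlim ?_ ?_
      · filter_upwards [self_mem_nhdsWithin] with y hy using powerForm_nonneg β r hy
      · filter_upwards [self_mem_nhdsWithin] with y hy
        by_cases h' : ∃ j, y j = 0
        · rw [powerForm, if_pos ⟨hq, h'⟩]
          exact Real.rpow_nonneg (share_nonneg hy i) _
        · push Not at h'
          have hy' : ∀ j, 0 < y j := fun j => (hy.1 j).lt_of_ne' (h' j)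
          have hs : 0 < share y i := div_pos (hy' i) (alloc_sum_pos hy)
          rw [powerForm_of_pos β r hy', Real.rpow_mul hs.le]
          refine Real.rpow_le_rpow_of_nonpos (Real.rpow_pos_of_pos hs _) ?_ (one_div_neg.2 hβ').le
          exact Finset.single_le_sum (f := fun j => share y j ^ (1 - β * r))
            (fun j _ => Real.rpow_nonneg (share_nonneg hy j) _) (Finset.mem_univ i)

lemma powerForm_one {β : ℝ} (hβ : β ≠ 0) (r : ℝ) {n : ℕ} (hn : 1 ≤ n) :
    powerForm β r (fun _ : Fin n => (1 : ℝ)) = (n : ℝ) ^ r := by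
  have hn' : (0 : ℝ) < n := by exact_mod_cast hn
  rw [powerForm_of_pos β r fun _ => one_pos]
  simp only [share_one, Finset.sum_const, Finset.card_univ, Fintype.card_fin, nsmul_eq_mul]
  rw [Real.inv_rpow hn'.le, ← Real.rpow_neg hn'.le]
  nth_rewrite 1 [← Real.rpow_one (n : ℝ)]
  rw [← Real.rpow_add hn', ← Real.rpow_mul hn'.le]
  congr 1
  field_simp
  ring

lemma powerForm_half {β : ℝ} (hβ : β ≠ 0) (r : ℝ) :
    powerForm β r ![(1 : ℝ) / 2, 1 / 2] = 2 ^ r := by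
  rw [show ![(1 : ℝ) / 2, 1 / 2] = (1 / 2 : ℝ) • (fun _ : Fin 2 => (1 : ℝ)) by
    ext i; fin_cases i <;> simp, powerForm_smul _ _ _ (by norm_num),
    powerForm_one hβ _ (by norm_num)]
  norm_num

/-- The equal split has value `2 ^ r`. The starved one has value `0`, `2 ^ r` or `1` according as `1
- β r` is negative, zero or positive; in the negative case `β < 0` forces `r < 0`. -/
lemma powerAdmissible_increasing_iff {σ β r : ℝ} (hσ : σ = 1 ∨ σ = -1) (hβ : β ≠ 0)
    (h : 0 ≤ 1 - β * r ∨ β < 0) :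
    0 ≤ σ * (r * (1 - β * r)) ↔
      σ * powerForm β r ![(1 : ℝ), 0] ≤ σ * powerForm β r ![(1 : ℝ) / 2, 1 / 2] := by
  rw [powerForm_half hβ]
  rcases lt_trichotomy (1 - β * r) 0 with hq | hq | hq
  · have hβ' : β < 0 := h.resolve_left (not_le.2 hq)
    have hr : r < 0 := by
      by_contra! hr
      nlinarith
    have h0 : powerForm β r ![(1 : ℝ), 0] = 0 := by rw [powerForm, if_pos ⟨hq, 1, rfl⟩]
    have h1 : 0 < r * (1 - β * r) := mul_pos_of_neg_of_neg hr hq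
    have h2 : (0 : ℝ) < 2 ^ r := by positivity
    rw [h0, mul_zero]
    rcases hσ with rfl | rfl
    · simp [h1.le, h2.le]
    · constructor <;> intro <;> linarith
  · have h0 : powerForm β r ![(1 : ℝ), 0] = 2 ^ r := by
      rw [powerForm_of_not fun h' => h'.1.ne hq]
      simp only [hq, Real.rpow_zero, Finset.sum_const, Finset.card_univ, Fintype.card_fin]
      have : 1 / β = r := by
        rw [div_eq_iff hβ]
        linarith
      rw [this]
      norm_num
    simp [h0, hq]
  · have h0 : powerForm β r ![(1 : ℝ), 0] = 1 := by
      rw [powerForm_of_not fun h' => h'.1.not_gt hq]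
      simp [share, Fin.sum_univ_two, Real.zero_rpow hq.ne']
    rw [h0, ← mul_assoc, mul_nonneg_iff_of_pos_right hq]
    rcases hσ with rfl | rfl
    · rw [one_mul, one_mul, one_mul]
      constructor
      · exact fun h => Real.one_le_rpow one_le_two h
      · intro h
        by_contra! h'
        exact absurd (Real.rpow_lt_one_of_one_lt_of_neg one_lt_two h') (not_lt.2 h)
    · constructor
      · intro h
        have := Real.rpow_le_one_of_one_le_of_nonpos (x := (2 : ℝ)) (z := r) one_le_two
          (by linarith)
        linarith
      · intro h
        by_contra! h'
        have := Real.one_lt_rpow (x := (2 : ℝ)) (z := r) one_lt_two (by linarith)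
        linarith

theorem fairnessAxioms_powerForm {σ β r : ℝ} (h : PowerAdmissible σ β r) :
    ∃ s : WeightSystem, HasPowerWeights s (1 - β * r) ∧
      FairnessAxioms (fun _ x => σ * powerForm β r x) (fun y => y ^ β) s := by
  obtain ⟨hσ, hβ, hq, hr⟩ := h
  have hσ0 : σ ≠ 0 := by rcases hσ with rfl | rfl <;> norm_num
  set q := 1 - β * r with hqdef
  refine ⟨fun m₁ m₂ y₁ y₂ => ((∑ j, y₁ j ^ q) / (∑ j, y₁ j ^ q + ∑ j, y₂ j ^ q),
    (∑ j, y₂ j ^ q) / (∑ j, y₁ j ^ q + ∑ j, y₂ j ^ q)), fun w₁ w₂ _ _ => by simp, ?_⟩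
  constructor
  · exact fun n _ => continuousOn_const.mul (continuousOn_powerForm hq n)
  · intro n _ x _ t ht
    simp only [powerForm_smul β r x ht]
  · intro x hx
    have : powerForm β r x = 1 := by
      rw [powerForm_of_pos β r fun i => by rwa [Subsingleton.elim i 0]]
      simp [share_single x hx]
    rcases hσ with rfl | rfl <;> simp [this]
  · refine (tendsto_succ_div_rpow r).congr' ?_
    filter_upwards [eventually_ge_atTop 1] with n hn
    rw [mul_div_mul_sign hσ, powerForm_one hβ r hn, powerForm_one hβ r (by omega)]
  · exact continuousOn_id.rpow_const fun y hy => Or.inl (ne_of_gt hy)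
  · rcases hβ.lt_or_gt with hβ | hβ
    · exact Or.inr fun x hx y _ hxy => Real.rpow_lt_rpow_of_neg hx hxy hβ
    · exact Or.inl fun x hx y _ hxy => Real.rpow_lt_rpow (le_of_lt hx) hxy hβ
  · intro m₁ m₂ y₁ hy₁ y₂ hy₂
    have h₁ := rpow_nonneg_sum_pos q hy₁
    have h₂ := rpow_nonneg_sum_pos q hy₂
    refine ⟨by positivity, by positivity, ?_⟩
    field_simp
  · intro n hn x hx
    refine mul_ne_zero hσ0 ?_
    rw [powerForm_of_pos β r hx]
    exact (Real.rpow_pos_of_pos (sum_share_rpow_pos _ (mem_alloc_of_pos hn hx)) _).ne'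
  · intro n₁ n₂ m₁ m₂ x₁ hx₁ x₂ hx₂ y₁ hy₁ y₂ hy₂ h₁ h₂ gx₁ gx₂ gy₁ gy₂ gx gy
    simp only [mul_div_mul_sign hσ]
    have hx := alloc_append hx₁ hx₂
    have hy := alloc_append hy₁ hy₂
    replace gx₁ := right_ne_zero_of_mul gx₁
    replace gx₂ := right_ne_zero_of_mul gx₂
    replace gy₁ := right_ne_zero_of_mul gy₁
    replace gy₂ := right_ne_zero_of_mul gy₂
    replace gx := right_ne_zero_of_mul gx
    replace gy := right_ne_zero_of_mul gy
    have px := powerForm_pos β r hx gx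
    have py := powerForm_pos β r hy gy
    have px₁ := powerForm_pos β r hx₁ gx₁
    have px₂ := powerForm_pos β r hx₂ gx₂
    have py₁ := powerForm_pos β r hy₁ gy₁
    have py₂ := powerForm_pos β r hy₂ gy₂
    refine ⟨div_pos px₁ py₁, div_pos px₂ py₂, div_pos px py, ?_⟩
    rw [Real.div_rpow px.le py.le, Real.div_rpow px₁.le py₁.le, Real.div_rpow px₂.le py₂.le,
      powerForm_rpow hβ hx gx, powerForm_rpow hβ hy gy, powerForm_rpow hβ hx₁ gx₁,
      powerForm_rpow hβ hx₂ gx₂, powerForm_rpow hβ hy₁ gy₁, powerForm_rpow hβ hy₂ gy₂,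
      sum_append x₁ x₂ (fun t => t), sum_append y₁ y₂ (fun t => t), ← hqdef,
      sum_append x₁ x₂ (fun t => t ^ q), sum_append y₁ y₂ (fun t => t ^ q), h₁, h₂]
    have := rpow_nonneg_sum_pos q hx₁
    have := rpow_nonneg_sum_pos q hx₂
    have := rpow_nonneg_sum_pos q hy₁
    have := rpow_nonneg_sum_pos q hy₂
    have t₁ := alloc_sum_pos hy₁
    have t₂ := alloc_sum_pos hy₂
    have := Real.rpow_pos_of_pos t₁ q
    have := Real.rpow_pos_of_pos t₂ q
    have := Real.rpow_pos_of_pos (add_pos t₁ t₂) q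
    field_simp
  · exact (powerAdmissible_increasing_iff hσ hβ hq).1 hr

/-! ### Existence and the Atkinson index. -/

lemma exists_isFairnessMeasure : ∃ f : (n : ℕ) → (Fin n → ℝ) → ℝ, IsFairnessMeasure f := by
  obtain ⟨s, -, h⟩ := fairnessAxioms_logForm (σ := 1) (r := 0) ⟨Or.inl rfl, by simp⟩
  exact ⟨_, _, s, h⟩

theorem powerForm_eq_atkinson {β r : ℝ} (hβ : β ≠ 0) (hr : β * r ≠ 1) {n : ℕ} (hn : 1 ≤ n)
    {x : Fin n → ℝ} (hx : ∀ i, 0 < x i) :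
    powerForm β r x = (n : ℝ) ^ r * (1 - atkinsonIndex (β * r) x) ^ ((1 - β * r) / β) := by
  have hxa := mem_alloc_of_pos hn hx
  have hT := alloc_sum_pos hxa
  have hS := rpow_nonneg_sum_pos (1 - β * r) hxa
  have hn' : (0 : ℝ) < n := by exact_mod_cast hn
  have hq : 1 - β * r ≠ 0 := sub_ne_zero.2 hr.symm
  rw [powerForm_of_pos β r hx, sum_share_rpow _ hxa, atkinsonIndex, sub_sub_cancel]
  set S := ∑ i, x i ^ (1 - β * r)
  set T := ∑ i, x i
  set q := 1 - β * r with hqdef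
  have hr' : r = (1 - q) / β := by
    rw [hqdef]
    field_simp
    ring
  -- After taking logarithms both sides are linear in `log S`, `log T` and `log n`.
  refine Real.log_injOn_pos (mem_Ioi.2 (by positivity)) (mem_Ioi.2 (by positivity)) ?_
  rw [Real.log_mul (by positivity) (by positivity), Real.log_rpow (by positivity),
    Real.log_rpow (by positivity), Real.log_rpow (by positivity),
    Real.log_div (by positivity) (by positivity), Real.log_div (by positivity) (by positivity),
    Real.log_rpow (by positivity), Real.log_rpow (by positivity),
    Real.log_div (by positivity) (by positivity), Real.log_div (by positivity) (by positivity),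
    hr']
  field_simp
  ring

/-! ### Completely additive functions with vanishing differences -/

/-- Halving descent: `M` is unchanged by doubling, and `n` exceeds `2 * (n / 2)` by at most one, so
each halving costs at most `ε`. The values below `2 * N` are absorbed in `K`. -/
lemma abs_le_log_of_abs_sub_le {M : ℕ → ℝ} (hadd : ∀ m n, 1 ≤ m → 1 ≤ n → M (m * n) = M m + M n)
    (h2 : M 2 = 0) {ε : ℝ} {N : ℕ} (hN : 1 ≤ N) (hε : ∀ n, N ≤ n → |M (n + 1) - M n| ≤ ε) :
    ∃ K, ∀ n, 1 ≤ n → |M n| ≤ K + ε * Nat.log 2 n := by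
  have hε0 : 0 ≤ ε := (abs_nonneg _).trans (hε N le_rfl)
  refine ⟨∑ n ∈ Finset.range (2 * N), |M n|, fun n => ?_⟩
  induction n using Nat.strong_induction_on with
  | _ n ih =>
    intro hn
    rcases lt_or_ge n (2 * N) with h | h
    · have := Finset.single_le_sum (f := fun n => |M n|) (fun i _ => abs_nonneg _)
        (Finset.mem_range.2 h)
      have h3 : 0 ≤ ε * Nat.log 2 n := by positivity
      linarith
    · have hq := ih (n / 2) (by omega) (by omega)
      have hlog : Nat.log 2 n = Nat.log 2 (n / 2) + 1 :=
        Nat.log_of_one_lt_of_le one_lt_two (by omega)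
      have h3 : M (2 * (n / 2)) = M (n / 2) := by
        rw [hadd 2 (n / 2) (by omega) (by omega), h2, zero_add]
      have h4 : |M n - M (2 * (n / 2))| ≤ ε := by
        rcases Nat.even_or_odd' n with ⟨c, hc | hc⟩
        · rw [show 2 * (n / 2) = n by omega, sub_self, abs_zero]
          exact hε0
        · have := hε (2 * (n / 2)) (by omega)
          rwa [show 2 * (n / 2) + 1 = n by omega] at this
      rw [hlog]
      push_cast
      have h5 : |M n| ≤ |M n - M (2 * (n / 2))| + |M (2 * (n / 2))| := by
        simpa using abs_add_le (M n - M (2 * (n / 2))) (M (2 * (n / 2)))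
      rw [h3] at h5
      rw [h3] at h4
      linarith

/-- The logarithmic bound is applied to `n ^ k`, where `M` equals `k * M n`. Dividing by `k` and
letting `k → ∞` leaves a bound proportional to the arbitrary `ε`. -/
lemma eq_zero_of_additive {M : ℕ → ℝ} (hadd : ∀ m n, 1 ≤ m → 1 ≤ n → M (m * n) = M m + M n)
    (h2 : M 2 = 0) (hlim : Tendsto (fun n => M (n + 1) - M n) atTop (𝓝 0)) {n : ℕ} (hn : 1 ≤ n) :
    M n = 0 := by
  have hpow : ∀ k : ℕ, M (n ^ k) = k * M n := by
    intro k
    induction k with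
    | zero =>
      have := hadd 1 1 le_rfl le_rfl
      simp only [mul_one] at this
      simp only [pow_zero, Nat.cast_zero, zero_mul]
      linarith
    | succ k ih =>
      rw [pow_succ, hadd _ _ (Nat.one_le_pow _ _ hn) hn, ih]
      push_cast
      ring
  have key : ∀ ε : ℝ, 0 < ε → |M n| ≤ ε * n := by
    intro ε hε
    obtain ⟨N, hN⟩ := (Metric.tendsto_atTop.1 hlim) ε hε
    obtain ⟨K, hK⟩ := abs_le_log_of_abs_sub_le hadd h2 (N := N + 1) (by omega) (ε := ε)
      fun m hm => by
        have := hN m (by omega)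
        rw [Real.dist_eq, sub_zero] at this
        exact this.le
    have hk : ∀ k : ℕ, 1 ≤ k → |M n| ≤ K / k + ε * n := by
      intro k hk
      have hk' : (0 : ℝ) < k := by exact_mod_cast hk
      have h1 := hK (n ^ k) (Nat.one_le_pow _ _ hn)
      have h3 : Nat.log 2 (n ^ k) ≤ n * k := by
        have : n ^ k ≤ 2 ^ (n * k) := by
          rw [pow_mul]
          exact Nat.pow_le_pow_left (Nat.lt_pow_self one_lt_two).le k
        calc Nat.log 2 (n ^ k) ≤ Nat.log 2 (2 ^ (n * k)) := Nat.log_mono_right this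
          _ = n * k := Nat.log_pow one_lt_two _
      have h4 : (Nat.log 2 (n ^ k) : ℝ) ≤ n * k := by exact_mod_cast h3
      rw [hpow, abs_mul, abs_of_pos hk'] at h1
      have h5 := mul_le_mul_of_nonneg_left h4 hε.le
      have h6 : (k : ℝ) * |M n| ≤ k * (K / k + ε * n) := by
        rw [mul_add, mul_div_cancel₀ _ hk'.ne']
        linarith
      exact le_of_mul_le_mul_left h6 hk'
    have hl : Tendsto (fun k : ℕ => K / k + ε * n) atTop (𝓝 (0 + ε * n)) :=
      (tendsto_const_div_atTop_nhds_zero_nat K).add_const _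
    rw [zero_add] at hl
    refine ge_of_tendsto hl ?_
    filter_upwards [eventually_ge_atTop 1] with k hk' using hk k hk'
  have hn' : (0 : ℝ) < n := by exact_mod_cast hn
  by_contra h
  have h1 := key (|M n| / (2 * n)) (by positivity)
  rw [div_mul_eq_mul_div, mul_div_mul_right _ _ hn'.ne'] at h1
  have := abs_pos.2 h
  linarith

/-- A completely multiplicative positive function with `φ (n + 1) / φ n → 1` is a power. -/
theorem exists_rpow_of_multiplicative {φ : ℕ → ℝ} (hpos : ∀ n, 1 ≤ n → 0 < φ n)
    (hmul : ∀ m n, 1 ≤ m → 1 ≤ n → φ (m * n) = φ m * φ n)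
    (hlim : Tendsto (fun n => φ (n + 1) / φ n) atTop (𝓝 1)) :
    ∃ r : ℝ, ∀ n : ℕ, 1 ≤ n → φ n = (n : ℝ) ^ r := by
  have hl2 : Real.log 2 ≠ 0 := (Real.log_pos one_lt_two).ne'
  -- This choice makes `log φ n - r log n` vanish at `2`.
  set r := Real.log (φ 2) / Real.log 2 with hr
  refine ⟨r, fun n hn => ?_⟩
  have hlog : ∀ m n : ℕ, 1 ≤ m → 1 ≤ n →
      Real.log ((m * n : ℕ) : ℝ) = Real.log m + Real.log n := by
    intro m n hm hn
    push_cast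
    exact Real.log_mul (by positivity) (by positivity)
  have h0 : Real.log (φ n) - r * Real.log n = 0 := by
    refine eq_zero_of_additive (M := fun n => Real.log (φ n) - r * Real.log n) ?_ ?_ ?_ hn
    · intro m n hm hn
      simp only [hmul m n hm hn, hlog m n hm hn,
        Real.log_mul (hpos m hm).ne' (hpos n hn).ne']
      ring
    · simp [hr, hl2]
    · have h1 : Tendsto (fun n => Real.log (φ (n + 1) / φ n)) atTop (𝓝 0) := by
        rw [← Real.log_one]
        exact hlim.log one_ne_zero
      have h2 : Tendsto (fun n : ℕ => Real.log (((n + 1 : ℕ) : ℝ) ^ r / (n : ℝ) ^ r)) atTop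
          (𝓝 0) := by
        rw [← Real.log_one]
        exact (tendsto_succ_div_rpow r).log one_ne_zero
      have h3 := h1.sub h2
      rw [sub_zero] at h3
      refine h3.congr' ?_
      filter_upwards [eventually_ge_atTop 1] with n hn
      have hn' : (0 : ℝ) < n := by exact_mod_cast hn
      have hn1 : (0 : ℝ) < (n + 1 : ℕ) := by positivity
      rw [Real.log_div (hpos _ (by omega)).ne' (hpos n hn).ne',
        Real.log_div (Real.rpow_pos_of_pos hn1 r).ne' (Real.rpow_pos_of_pos hn' r).ne',
        Real.log_rpow hn1, Real.log_rpow hn']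
      ring
  have hn' : (0 : ℝ) < n := by exact_mod_cast hn
  refine Real.log_injOn_pos (hpos n hn) (Real.rpow_pos_of_pos hn' r) ?_
  rw [Real.log_rpow hn']
  linarith

/-! ### Translation invariant weighted means -/

lemma exists_weighted_mean {P : ℝ → ℝ} (hP : Continuous P) {s₁ s₂ : ℝ} (h₁ : 0 < s₁) (h₂ : 0 < s₂)
    (h : s₁ + s₂ = 1) (a b : ℝ) : ∃ m ∈ uIcc a b, P m = s₁ * P a + s₂ * P b := by
  have hmem : s₁ * P a + s₂ * P b ∈ uIcc (P a) (P b) := by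
    obtain rfl : s₂ = 1 - s₁ := by linarith
    rw [mem_uIcc]
    rcases le_total (P a) (P b) with hab | hab
    · left
      constructor <;> nlinarith
    · right
      constructor <;> nlinarith
  exact intermediate_value_uIcc hP.continuousOn hmem

/-- Subtract from `Q` the affine function of `P` that agrees with it at `a` and `b`. The zero set of
the difference `ψ` is closed and stable under the mean. A point outside it would lie in a gap `(c,
d)`, but the mean of `c` and `d` is a zero lying strictly between them. -/
lemma affine_on_Icc_of_mean {P Q : ℝ → ℝ} (hP : Continuous P) (hPi : Function.Injective P)
    (hQ : Continuous Q) {s₁ s₂ : ℝ} (h₁ : 0 < s₁) (h₂ : 0 < s₂) (h : s₁ + s₂ = 1)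
    (hPQ : ∀ a b m, P m = s₁ * P a + s₂ * P b → Q m = s₁ * Q a + s₂ * Q b) {a b : ℝ}
    (hab : a < b) : ∃ A B, ∀ t ∈ Icc a b, Q t = A * P t + B := by
  set A := (Q b - Q a) / (P b - P a)
  set ψ : ℝ → ℝ := fun t => Q t - A * P t - (Q a - A * P a) with hψ
  have hne : P b - P a ≠ 0 := sub_ne_zero.2 (hPi.ne hab.ne')
  have hA : A * (P b - P a) = Q b - Q a := div_mul_cancel₀ _ hne
  have hψc : Continuous ψ := by fun_prop
  have hψa : ψ a = 0 := by simp [hψ]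
  have hψb : ψ b = 0 := by
    simp only [hψ]
    linarith
  have hψm : ∀ c d m, P m = s₁ * P c + s₂ * P d → ψ c = 0 → ψ d = 0 → ψ m = 0 := by
    intro c d m hm hc hd
    have hQm := hPQ c d m hm
    simp only [hψ] at hc hd ⊢
    rw [hQm, hm]
    obtain rfl : s₂ = 1 - s₁ := by linarith
    linear_combination s₁ * hc + (1 - s₁) * hd
  refine ⟨A, Q a - A * P a, fun t ht => ?_⟩
  suffices ψ t = 0 by
    simp only [hψ] at this
    linarith
  by_contra hne
  have hZ : IsClosed {t | ψ t = 0} := isClosed_eq hψc continuous_const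
  obtain ⟨c, ⟨⟨hca, hct⟩, hc0⟩, hcmax⟩ := ((isCompact_Icc (a := a) (b := t)).inter_right
    hZ).exists_isGreatest ⟨a, ⟨le_rfl, ht.1⟩, hψa⟩
  obtain ⟨d, ⟨⟨hdt, hdb⟩, hd0⟩, hdmin⟩ := ((isCompact_Icc (a := t) (b := b)).inter_right
    hZ).exists_isLeast ⟨b, ⟨ht.2, le_rfl⟩, hψb⟩
  have hc0' : ψ c = 0 := hc0
  have hd0' : ψ d = 0 := hd0
  have hct' : c < t := hct.lt_of_ne fun e => hne (e ▸ hc0')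
  have hdt' : t < d := hdt.lt_of_ne fun e => hne (e ▸ hd0')
  have hcd : P c ≠ P d := hPi.ne (hct'.trans hdt').ne
  obtain ⟨m, hm, hPm⟩ := exists_weighted_mean hP h₁ h₂ h c d
  rw [uIcc_of_le (hct'.trans hdt').le] at hm
  have hm0 := hψm c d m hPm hc0' hd0'
  obtain rfl : s₂ = 1 - s₁ := by linarith
  rcases le_or_gt m t with hmt | hmt
  · have : m = c := le_antisymm (hcmax ⟨⟨hca.trans hm.1, hmt⟩, hm0⟩) hm.1
    subst this
    refine hcd (mul_left_cancel₀ h₂.ne' ?_)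
    linarith
  · have : m = d := le_antisymm hm.2 (hdmin ⟨⟨hmt.le, hm.2.trans hdb⟩, hm0⟩)
    subst this
    refine hcd (mul_left_cancel₀ h₁.ne' ?_)
    linarith

/-- Functions with the same weighted quasi-arithmetic mean are affinely related. -/
theorem affine_of_mean {P Q : ℝ → ℝ} (hP : Continuous P) (hPi : Function.Injective P)
    (hQ : Continuous Q) {s₁ s₂ : ℝ} (h₁ : 0 < s₁) (h₂ : 0 < s₂) (h : s₁ + s₂ = 1)
    (hPQ : ∀ a b m, P m = s₁ * P a + s₂ * P b → Q m = s₁ * Q a + s₂ * Q b) :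
    ∃ A B, ∀ t, Q t = A * P t + B := by
  obtain ⟨A, B, hAB⟩ := affine_on_Icc_of_mean hP hPi hQ h₁ h₂ h hPQ zero_lt_one
  refine ⟨A, B, fun t => ?_⟩
  -- The interval contains `0`, `1` and `t`; the values at `0` and `1` identify the new coefficients
  -- with the old ones.
  obtain ⟨A', B', hAB'⟩ := affine_on_Icc_of_mean hP hPi hQ h₁ h₂ h hPQ
    (a := min t 0) (b := max t 1) ((min_le_right _ _).trans_lt
      (zero_lt_one.trans_le (le_max_right _ _)))
  have e0 := hAB 0 (by simp)
  have e1 := hAB 1 (by simp)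
  have e0' := hAB' 0 ⟨min_le_right _ _, zero_le_one.trans (le_max_right _ _)⟩
  have e1' := hAB' 1 ⟨(min_le_right _ _).trans zero_le_one, le_max_right _ _⟩
  have et := hAB' t ⟨min_le_left _ _, le_max_left _ _⟩
  have hne : P 1 - P 0 ≠ 0 := sub_ne_zero.2 (hPi.ne one_ne_zero)
  have hA : A' = A := mul_right_cancel₀ hne (by linarith)
  subst hA
  linarith

lemma eq_mul_of_continuous_additive {p : ℝ → ℝ} (hp : Continuous p)
    (hadd : ∀ s t, p (s + t) = p s + p t) (t : ℝ) : p t = p 1 * t := by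
  have := map_real_smul (AddMonoidHom.mk' p hadd) hp t 1
  simpa [mul_comm] using this

/-- If translates of `P` are affine functions of `P`, then `P` is affine or exponential. -/
theorem affine_or_exp_of_translates {P : ℝ → ℝ} (hP : Continuous P) (hPi : Function.Injective P)
    (h : ∀ l, ∃ A B, ∀ t, P (t + l) = A * P t + B) :
    (∃ c d, c ≠ 0 ∧ ∀ t, P t = c * t + d) ∨
      ∃ c d κ, c ≠ 0 ∧ κ ≠ 0 ∧ ∀ t, P t = c * Real.exp (κ * t) + d := by
  choose A B hAB using h
  set p : ℝ → ℝ := fun t => P t - P 0 with hp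
  have hpc : Continuous p := by fun_prop
  have hpA : ∀ t l, p (t + l) = A l * p t + p l := by
    intro t l
    have h1 := hAB l t
    have h2 := hAB l 0
    rw [zero_add] at h2
    simp only [hp]
    rw [h1, h2]
    ring
  have hp1 : p 1 ≠ 0 := sub_ne_zero.2 (hPi.ne one_ne_zero)
  -- Evaluating `p (t + l)` with the roles of `t` and `l` exchanged shows that `A - 1` is a multiple
  -- of `p`. If `k = 0`, `p` is additive; otherwise `A` is multiplicative.
  set k := (A 1 - 1) / p 1
  have hAk : ∀ l, A l = 1 + k * p l := by
    intro l
    have h1 := hpA 1 l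
    rw [add_comm, hpA l 1] at h1
    have h2 : k * p 1 = A 1 - 1 := div_mul_cancel₀ _ hp1
    refine mul_right_cancel₀ hp1 ?_
    linear_combination -h1 - p l * h2
  have hPp : ∀ t, P t = p t + P 0 := fun t => by simp [hp]
  by_cases hk : k = 0
  · refine Or.inl ⟨p 1, P 0, hp1, fun t => ?_⟩
    rw [hPp, eq_mul_of_continuous_additive hpc fun s t => by rw [hpA, hAk, hk]; ring]
  · have hAc : Continuous A := by
      rw [show A = fun l => 1 + k * p l from funext hAk]
      fun_prop
    have hAmul : ∀ s t, A (s + t) = A s * A t := by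
      intro s t
      rw [hAk (s + t), hpA, hAk t, hAk s]
      ring
    have hA0 : A 0 = 1 := by rw [hAk]; simp [hp]
    have hApos : ∀ t, 0 < A t := by
      intro t
      have h1 : A t = A (t / 2) * A (t / 2) := by rw [← hAmul, add_halves]
      have h2 : A t * A (-t) = 1 := by rw [← hAmul, add_neg_cancel, hA0]
      refine lt_of_le_of_ne (h1 ▸ mul_self_nonneg _) fun h0 => ?_
      rw [← h0, zero_mul] at h2
      exact zero_ne_one h2
    have hlog : ∀ t, Real.log (A t) = Real.log (A 1) * t :=
      eq_mul_of_continuous_additive (p := fun t => Real.log (A t))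
        (hAc.log fun t => (hApos t).ne') fun s t => by
          rw [hAmul, Real.log_mul (hApos s).ne' (hApos t).ne']
    have hexp : ∀ t, A t = Real.exp (Real.log (A 1) * t) := fun t => by
      rw [← hlog, Real.exp_log (hApos t)]
    refine Or.inr ⟨k⁻¹, P 0 - k⁻¹, Real.log (A 1), inv_ne_zero hk, fun h0 => ?_, fun t => ?_⟩
    · have h1 := hexp 1
      rw [h0, zero_mul, Real.exp_zero, hAk] at h1
      exact mul_ne_zero hk hp1 (by linarith)
    · rw [← hexp, hAk, hPp]
      field_simp
      ring

lemma dense_log_div :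
    Dense {t : ℝ | ∃ n k : ℕ, 1 ≤ n ∧ 1 ≤ k ∧ t = Real.log ((n : ℝ) / k)} := by
  refine dense_of_exists_between fun a b hab => ?_
  obtain ⟨q, hq1, hq2⟩ := exists_rat_btwn (Real.exp_lt_exp.2 hab)
  have hq : (0 : ℝ) < q := (Real.exp_pos a).trans hq1
  have hq' : 0 < q := by exact_mod_cast hq
  refine ⟨Real.log q, ⟨q.num.toNat, q.den, ?_, q.den_pos, ?_⟩, (Real.lt_log_iff_exp_lt hq).2 hq1,
    (Real.log_lt_iff_lt_exp hq).2 hq2⟩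
  · have := Rat.num_pos.2 hq'
    omega
  · congr 1
    have h1 : ((q.num.toNat : ℤ) : ℝ) = (q.num : ℝ) := by
      rw [Int.toNat_of_nonneg (Rat.num_pos.2 hq').le]
    rw [← Int.cast_natCast (q.num.toNat), h1]
    exact Rat.cast_def q

lemma isEmbedding_of_continuous_injective {P : ℝ → ℝ} (hP : Continuous P)
    (hPi : Function.Injective P) : IsEmbedding P := by
  rcases hP.strictMono_of_inj hPi with h | h
  · exact h.isEmbedding_of_ordConnected (isPreconnected_range hP).ordConnected
  · have h1 : StrictMono (fun t => -P t) := fun a b hab => neg_lt_neg (h hab)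
    have h2 := h1.isEmbedding_of_ordConnected (isPreconnected_range hP.neg).ordConnected
    have h3 := (Homeomorph.neg ℝ).isEmbedding.comp h2
    convert h3 using 1
    ext t
    simp

/-- A weighted quasi-arithmetic mean which is invariant under translations, for a dense set of
arguments and translations, belongs to an affine or exponential function. -/
theorem affine_or_exp_of_dense {P : ℝ → ℝ} (hP : Continuous P) (hPi : Function.Injective P)
    {s₁ s₂ : ℝ} (h₁ : 0 < s₁) (h₂ : 0 < s₂) (h : s₁ + s₂ = 1)
    (hD : ∀ n m k p q : ℕ, 1 ≤ n → 1 ≤ m → 1 ≤ k → 1 ≤ p → 1 ≤ q → ∃ μ,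
      P μ = s₁ * P (Real.log (n / k)) + s₂ * P (Real.log (m / k)) ∧
      P (μ + Real.log (p / q)) = s₁ * P (Real.log (n / k) + Real.log (p / q)) +
        s₂ * P (Real.log (m / k) + Real.log (p / q))) :
    (∃ c d, c ≠ 0 ∧ ∀ t, P t = c * t + d) ∨
      ∃ c d κ, c ≠ 0 ∧ κ ≠ 0 ∧ ∀ t, P t = c * Real.exp (κ * t) + d := by
  choose M _ hPM using fun a b => exists_weighted_mean hP h₁ h₂ h a b
  -- Continuity of the mean, needed for the density argument, holds because `P` is an embedding.
  have hMc : Continuous fun z : ℝ × ℝ => M z.1 z.2 := by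
    rw [(isEmbedding_of_continuous_injective hP hPi).continuous_iff]
    have : P ∘ (fun z : ℝ × ℝ => M z.1 z.2) = fun z => s₁ * P z.1 + s₂ * P z.2 :=
      funext fun z => hPM z.1 z.2
    rw [this]
    fun_prop
  have hall : (fun z : ℝ × ℝ × ℝ => P (M z.1 z.2.1 + z.2.2)) =
      fun z => s₁ * P (z.1 + z.2.2) + s₂ * P (z.2.1 + z.2.2) := by
    refine Continuous.ext_on (dense_log_div.prod (dense_log_div.prod dense_log_div)) ?_
      (by fun_prop) ?_
    · have : Continuous fun z : ℝ × ℝ × ℝ => M z.1 z.2.1 :=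
        hMc.comp (continuous_fst.prodMk (continuous_fst.comp continuous_snd))
      fun_prop
    · rintro ⟨_, _, _⟩ ⟨⟨n, k, hn, hk, rfl⟩, ⟨m, l, hm, hl, rfl⟩, ⟨p, q, hp, hq, rfl⟩⟩
      have hk' : (k : ℝ) ≠ 0 := by positivity
      have hl' : (l : ℝ) ≠ 0 := by positivity
      -- The hypothesis covers only fractions with a common denominator, here `k * l`.
      obtain ⟨μ, hμ, hμ'⟩ := hD (n * l) (m * k) (k * l) p q (Nat.mul_pos hn hl) (Nat.mul_pos hm hk)
        (Nat.mul_pos hk hl) hp hq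
      have e1 : ((n * l : ℕ) : ℝ) / (k * l : ℕ) = n / k := by
        push_cast
        field_simp
      have e2 : ((m * k : ℕ) : ℝ) / (k * l : ℕ) = m / l := by
        push_cast
        field_simp
      rw [e1, e2] at hμ hμ'
      have : μ = M (Real.log (n / k)) (Real.log (m / l)) := hPi (by rw [hμ, hPM])
      rw [this] at hμ'
      exact hμ'
  refine affine_or_exp_of_translates hP hPi fun l => ?_
  refine affine_of_mean hP hPi (Q := fun t => P (t + l)) (by fun_prop) h₁ h₂ h fun a b m hm => ?_
  have : m = M a b := hPi (by rw [hm, hPM])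
  rw [this]
  exact congrFun hall (a, b, l)

/-! ### Fairness of lists of positive reals -/

/-- Nonempty lists of positive reals. -/
def PosList (l : List ℝ) : Prop := l ≠ [] ∧ ∀ a ∈ l, 0 < a

lemma PosList.append {l₁ l₂ : List ℝ} (h₁ : PosList l₁) (h₂ : PosList l₂) : PosList (l₁ ++ l₂) :=
  ⟨by simp [h₁.1], fun a ha => (List.mem_append.1 ha).elim (h₁.2 a) (h₂.2 a)⟩

lemma posList_single {a : ℝ} (ha : 0 < a) : PosList [a] := ⟨by simp, by simpa using ha⟩

lemma posList_replicate {n : ℕ} (hn : 1 ≤ n) {a : ℝ} (ha : 0 < a) :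
    PosList (List.replicate n a) :=
  ⟨by rw [Ne, List.replicate_eq_nil_iff]; omega, fun b hb => by rwa [List.eq_of_mem_replicate hb]⟩

lemma PosList.get_mem_alloc {l : List ℝ} (h : PosList l) : l.get ∈ Alloc l.length :=
  mem_alloc_of_pos (List.length_pos_of_ne_nil h.1) fun i => h.2 _ (List.get_mem l i)

lemma sum_get (l : List ℝ) : ∑ i, l.get i = l.sum := by
  rw [← List.sum_ofFn, List.ofFn_get]

lemma PosList.sum_pos {l : List ℝ} (h : PosList l) : 0 < l.sum := by
  rw [← sum_get]
  exact alloc_sum_pos h.get_mem_alloc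

/-- The length of `List.ofFn x` is only propositionally `n`; equality in the sigma type of tuples
avoids casts. -/
lemma apply_ofFn_get {α β : Type*} (f : (n : ℕ) → (Fin n → α) → β) {n : ℕ} (x : Fin n → α) :
    f (List.ofFn x).length (List.ofFn x).get = f n x :=
  congrArg (fun p : Σ n, Fin n → α => f p.1 p.2) (List.equivSigmaTuple.right_inv ⟨n, x⟩)

lemma apply_append_get {α β : Type*} (f : (n : ℕ) → (Fin n → α) → β) (l₁ l₂ : List α) :
    f (l₁ ++ l₂).length (l₁ ++ l₂).get =
      f (l₁.length + l₂.length) (Fin.append l₁.get l₂.get) := by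
  rw [← apply_ofFn_get f (Fin.append l₁.get l₂.get), List.ofFn_fin_append, List.ofFn_get,
    List.ofFn_get]

lemma apply_map_get {α β : Type*} (f : (n : ℕ) → (Fin n → α) → β) (φ : α → α) (l : List α) :
    f (l.map φ).length (l.map φ).get = f l.length (φ ∘ l.get) := by
  rw [← apply_ofFn_get f (φ ∘ l.get), ← List.map_ofFn, List.ofFn_get]

/-- The fairness axioms for positive allocations, written as lists, with positive values. -/
structure ListFairness (F : List ℝ → ℝ) (g : ℝ → ℝ) (w : List ℝ → List ℝ → ℝ × ℝ) : Prop where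
  pos : ∀ l, PosList l → 0 < F l
  homogeneity : ∀ l, PosList l → ∀ t : ℝ, 0 < t → F (l.map (t * ·)) = F l
  single : ∀ a, 0 < a → F [a] = 1
  boundedness : Tendsto (fun n : ℕ => F (List.replicate (n + 1) 1) / F (List.replicate n 1)) atTop
    (𝓝 1)
  generator_continuous : ContinuousOn g (Ioi 0)
  generator_injective : InjOn g (Ioi 0)
  weights : ∀ y₁ y₂, PosList y₁ → PosList y₂ →
    0 < (w y₁ y₂).1 ∧ 0 < (w y₁ y₂).2 ∧ (w y₁ y₂).1 + (w y₁ y₂).2 = 1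
  partition : ∀ x₁ x₂ y₁ y₂, PosList x₁ → PosList x₂ → PosList y₁ → PosList y₂ →
    x₁.sum = y₁.sum → x₂.sum = y₂.sum →
    g (F (x₁ ++ x₂) / F (y₁ ++ y₂)) =
      (w y₁ y₂).1 * g (F x₁ / F y₁) + (w y₁ y₂).2 * g (F x₂ / F y₂)

/-- The weights of a weight system, relative to lists. -/
def WeightSystem.onLists (s : WeightSystem) (y₁ y₂ : List ℝ) : ℝ × ℝ :=
  s y₁.length y₂.length y₁.get y₂.get

/-- The values of a fairness measure on lists, normalized by the value of a single user. -/
def onLists (f : (n : ℕ) → (Fin n → ℝ) → ℝ) (l : List ℝ) : ℝ :=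
  f 1 (fun _ => 1) * f l.length l.get

/-! ### From the axioms to positive lists. -/

namespace FairnessAxioms

variable {f : (n : ℕ) → (Fin n → ℝ) → ℝ} {g : ℝ → ℝ} {s : WeightSystem}

lemma sign (h : FairnessAxioms f g s) : f 1 (fun _ => 1) = 1 ∨ f 1 (fun _ => 1) = -1 :=
  eq_or_eq_neg_of_abs_eq (h.single _ one_pos)

lemma sign_mul_self (h : FairnessAxioms f g s) : f 1 (fun _ => 1) * f 1 (fun _ => 1) = 1 := by
  rcases h.sign with h | h <;> rw [h] <;> norm_num

lemma eq_sign_mul (h : FairnessAxioms f g s) {n : ℕ} (x : Fin n → ℝ) :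
    f n x = f 1 (fun _ => 1) * onLists f (List.ofFn x) := by
  rw [onLists, apply_ofFn_get f, ← mul_assoc, h.sign_mul_self, one_mul]

lemma apply_single (h : FairnessAxioms f g s) {a : ℝ} (ha : 0 < a) :
    f 1 (fun _ => a) = f 1 (fun _ => 1) := by
  rw [h.homogeneity 1 le_rfl (fun _ => 1) (mem_alloc_of_pos le_rfl fun _ => one_pos) a ha]
  congr 1
  ext
  simp

/-- Partition asserts that block ratios are positive. Comparing `x` with a single user holding the
same total, next to a dummy second block, shows that `f n x` has the sign of `f 1`. -/
lemma sign_mul_pos (h : FairnessAxioms f g s) {n : ℕ} (hn : 1 ≤ n) {x : Fin n → ℝ}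
    (hx : ∀ i, 0 < x i) : 0 < f 1 (fun _ => 1) * f n x := by
  have hxa := mem_alloc_of_pos hn hx
  have hT := alloc_sum_pos hxa
  have h1 : ∀ a : ℝ, 0 < a → (fun _ => a) ∈ Alloc 1 := fun a ha =>
    mem_alloc_of_pos le_rfl fun _ => ha
  have happ : ∀ {m k : ℕ} {y : Fin m → ℝ} {z : Fin k → ℝ}, 1 ≤ m → (∀ i, 0 < y i) →
      (∀ i, 0 < z i) → f (m + k) (Fin.append y z) ≠ 0 := by
    intro m k y z hm hy hz
    refine h.nonvanishing _ (by omega) _ fun i => ?_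
    refine Fin.addCases (fun i => ?_) (fun i => ?_) i
    · simpa using hy i
    · simpa using hz i
  have key := (h.partition n 1 1 1 x hxa (fun _ => 1) (h1 1 one_pos) (fun _ => ∑ i, x i) (h1 _ hT)
    (fun _ => 1) (h1 1 one_pos) (by simp) (by simp) (h.nonvanishing n hn x hx)
    (h.nonvanishing 1 le_rfl _ fun _ => one_pos) (h.nonvanishing 1 le_rfl _ fun _ => hT)
    (h.nonvanishing 1 le_rfl _ fun _ => one_pos) (happ hn hx fun _ => one_pos)
    (happ le_rfl (fun _ => hT) fun _ => one_pos)).1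
  rw [h.apply_single hT] at key
  rcases h.sign with e | e <;> rw [e] at key ⊢
  · simpa using key
  · rw [div_neg, div_one] at key
    linarith

lemma onLists_pos (h : FairnessAxioms f g s) {l : List ℝ} (hl : PosList l) : 0 < onLists f l :=
  h.sign_mul_pos (List.length_pos_of_ne_nil hl.1) fun i => hl.2 _ (List.get_mem l i)

lemma onLists_replicate (n : ℕ) (a : ℝ) :
    onLists f (List.replicate n a) = f 1 (fun _ => 1) * f n (fun _ => a) := by
  rw [onLists, ← List.ofFn_const, apply_ofFn_get f]

theorem listFairness (h : FairnessAxioms f g s) : ListFairness (onLists f) g s.onLists where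
  pos _ hl := h.onLists_pos hl
  homogeneity l hl t ht := by
    rw [onLists, apply_map_get f, onLists,
      h.homogeneity _ (List.length_pos_of_ne_nil hl.1) _ hl.get_mem_alloc t ht]
    rfl
  single a ha := by
    rw [← List.replicate_one, onLists_replicate, h.apply_single ha, h.sign_mul_self]
  boundedness := by
    simp only [onLists_replicate, mul_div_mul_sign h.sign]
    exact h.boundedness
  generator_continuous := h.generator_continuous
  generator_injective := h.generator_monotonic.elim StrictMonoOn.injOn StrictAntiOn.injOn
  weights y₁ y₂ h₁ h₂ := h.weights _ _ _ h₁.get_mem_alloc _ h₂.get_mem_alloc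
  partition x₁ x₂ y₁ y₂ hx₁ hx₂ hy₁ hy₂ h₁ h₂ := by
    have hne : ∀ {l}, PosList l → f l.length l.get ≠ 0 := fun hl =>
      right_ne_zero_of_mul (h.onLists_pos hl).ne'
    have hx := hne (hx₁.append hx₂)
    have hy := hne (hy₁.append hy₂)
    rw [apply_append_get f] at hx hy
    simp only [onLists, mul_div_mul_sign h.sign]
    rw [apply_append_get f, apply_append_get f]
    exact (h.partition _ _ _ _ _ hx₁.get_mem_alloc _ hx₂.get_mem_alloc _ hy₁.get_mem_alloc _
      hy₂.get_mem_alloc (by rw [sum_get, sum_get, h₁]) (by rw [sum_get, sum_get, h₂]) (hne hx₁)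
      (hne hx₂) (hne hy₁) (hne hy₂) hx hy).2.2.2

end FairnessAxioms

/-! ### Equal allocations and the generator. -/

namespace ListFairness

variable {F : List ℝ → ℝ} {g : ℝ → ℝ} {w : List ℝ → List ℝ → ℝ × ℝ}

/-- Replacing every entry by a block with the same total and fairness `C` multiplies the
fairness by `C`. -/
lemma flatMap (h : ListFairness F g w) {B : ℝ → List ℝ} {C : ℝ} (l : List ℝ) (hl : l ≠ [])
    (hB : ∀ a ∈ l, 0 < a ∧ PosList (B a) ∧ (B a).sum = a ∧ F (B a) = C) :
    PosList (l.flatMap B) ∧ (l.flatMap B).sum = l.sum ∧ F (l.flatMap B) = C * F l := by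
  induction l with
  | nil => exact absurd rfl hl
  | cons a l ih =>
    obtain ⟨ha, hBa, hsum, hC⟩ := hB a (by simp)
    rcases eq_or_ne l [] with rfl | hne
    · simp only [List.flatMap_cons, List.flatMap_nil, List.append_nil, List.sum_singleton,
        h.single a ha, mul_one]
      exact ⟨hBa, hsum, hC⟩
    · obtain ⟨i1, i2, i3⟩ := ih hne fun b hb => hB b (List.mem_cons_of_mem a hb)
      have hlp : PosList l := ⟨hne, fun b hb => (hB b (List.mem_cons_of_mem a hb)).1⟩
      have halp := (posList_single ha).append hlp
      have hpos := hBa.append i1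
      rw [List.flatMap_cons]
      refine ⟨hpos, by rw [List.sum_append, List.sum_cons, hsum, i2], ?_⟩
      -- Both block ratios equal `C`, so the weights sum out and injectivity of `g` finishes.
      have key := h.partition (B a) (l.flatMap B) [a] l hBa i1 (posList_single ha) hlp
        (by simpa using hsum) i2
      have hF := h.pos l hlp
      have hw := (h.weights [a] l (posList_single ha) hlp).2.2
      rw [i3, hC, h.single a ha, div_one, mul_div_assoc, div_self hF.ne', mul_one, ← add_mul, hw,
        one_mul] at key
      have hC0 : 0 < C := hC ▸ h.pos _ hBa
      have h2 := h.generator_injective (div_pos (h.pos _ hpos) (h.pos _ halp)) hC0 key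
      rw [div_eq_iff (h.pos _ halp).ne'] at h2
      simpa using h2

lemma replicate_eq (h : ListFairness F g w) {n : ℕ} (hn : 1 ≤ n) {a : ℝ} (ha : 0 < a) :
    F (List.replicate n a) = F (List.replicate n 1) := by
  have := h.homogeneity (List.replicate n 1) (posList_replicate hn one_pos) a ha
  simpa using this

lemma sum_replicate_div {p : ℕ} (hp : 1 ≤ p) (a : ℝ) :
    (List.replicate p (a / p)).sum = a := by
  have : (p : ℝ) ≠ 0 := by positivity
  rw [List.sum_replicate, nsmul_eq_mul, mul_div_cancel₀ _ this]

lemma flatMap_replicate (h : ListFairness F g w) {p : ℕ} (hp : 1 ≤ p) {l : List ℝ}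
    (hl : PosList l) :
    F (l.flatMap fun a => List.replicate p (a / p)) = F (List.replicate p 1) * F l := by
  refine (h.flatMap l hl.1 fun a ha => ?_).2.2
  have ha := hl.2 a ha
  have : 0 < a / p := by positivity
  exact ⟨ha, posList_replicate hp this, sum_replicate_div hp a, h.replicate_eq hp this⟩

lemma flatMap_replicate_replicate (m p : ℕ) (a : ℝ) (b : ℝ → ℝ) :
    ((List.replicate m a).flatMap fun a => List.replicate p (b a)) =
      List.replicate (m * p) (b a) := by
  rw [List.flatMap_replicate, List.flatten_replicate_replicate]

theorem exists_rpow (h : ListFairness F g w) :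
    ∃ r : ℝ, ∀ n : ℕ, 1 ≤ n → F (List.replicate n 1) = (n : ℝ) ^ r := by
  refine exists_rpow_of_multiplicative (φ := fun n => F (List.replicate n 1))
    (fun n hn => h.pos _ (posList_replicate hn one_pos)) (fun m n hm hn => ?_) h.boundedness
  have := h.flatMap_replicate hn (posList_replicate hm one_pos)
  rw [flatMap_replicate_replicate, h.replicate_eq (Nat.mul_pos hm hn) (by positivity)] at this
  rw [this, mul_comm]

/-- Splitting each integer `k` into `k` ones multiplies the fairness by `1` and produces an equal
allocation, which has fairness `1`. -/
lemma eq_one_of_replicate (h : ListFairness F g w)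
    (h1 : ∀ n : ℕ, 1 ≤ n → F (List.replicate n 1) = 1) {l : List ℕ} (hl : l ≠ [])
    (hpos : ∀ k ∈ l, 1 ≤ k) : F (l.map (↑)) = 1 := by
  have key := h.flatMap (B := fun a => List.replicate ⌊a⌋₊ 1) (C := 1) (l.map (↑)) (by simpa using hl)
    (by
      intro a ha
      obtain ⟨k, hk, rfl⟩ := List.mem_map.1 ha
      have hk := hpos k hk
      simp only [Nat.floor_natCast]
      exact ⟨by positivity, posList_replicate hk one_pos, by simp, h1 k hk⟩)
  have e : (l.map ((↑) : ℕ → ℝ)).flatMap (fun a => List.replicate ⌊a⌋₊ (1 : ℝ)) =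
      List.replicate l.sum 1 := by
    clear key hl hpos
    induction l with
    | nil => simp
    | cons a l ih =>
      rw [List.map_cons, List.flatMap_cons, ih, List.sum_cons, Nat.floor_natCast,
        List.replicate_append_replicate]
  have hs : 1 ≤ l.sum := by
    obtain ⟨k, hk⟩ := List.exists_mem_of_ne_nil l hl
    exact (hpos k hk).trans (List.le_sum_of_mem hk)
  rw [e, h1 _ hs, one_mul] at key
  exact key.2.2.symm

/-- The generator of a list fairness with `F (1, …, 1) = n ^ r`, `r ≠ 0`, is affine or exponential
in logarithmic coordinates. -/
theorem generator_comp_exp (h : ListFairness F g w) {r : ℝ} (hr : r ≠ 0)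
    (hF : ∀ n : ℕ, 1 ≤ n → F (List.replicate n 1) = (n : ℝ) ^ r) :
    (∃ c d, c ≠ 0 ∧ ∀ t, g (Real.exp (r * t)) = c * t + d) ∨
      ∃ c d κ, c ≠ 0 ∧ κ ≠ 0 ∧ ∀ t, g (Real.exp (r * t)) = c * Real.exp (κ * t) + d := by
  set A : ℕ → List ℝ := fun n => List.replicate n (1 / n) with hA
  have hApos : ∀ {n}, 1 ≤ n → PosList (A n) := fun hn => posList_replicate hn (by positivity)
  have hFA : ∀ {n : ℕ}, 1 ≤ n → F (A n) = (n : ℝ) ^ r := fun hn => by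
    rw [← hF _ hn]
    exact h.replicate_eq hn (by positivity)
  have hAsum : ∀ {n}, 1 ≤ n → (A n).sum = 1 := fun hn => sum_replicate_div hn 1
  have hAmul : ∀ n p : ℕ, ((A n).flatMap fun a : ℝ => List.replicate p (a / p)) = A (n * p) := by
    intro n p
    simp only [hA]
    rw [flatMap_replicate_replicate (b := fun a => a / p)]
    push_cast
    rw [div_div]
  set H : ℕ → ℕ → ℝ := fun n m => F (A n ++ A m) with hH
  have hHpos : ∀ {n m}, 1 ≤ n → 1 ≤ m → 0 < H n m := fun hn hm =>
    h.pos _ ((hApos hn).append (hApos hm))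
  have hHmul : ∀ {n m p : ℕ}, 1 ≤ n → 1 ≤ m → 1 ≤ p → H (n * p) (m * p) = (p : ℝ) ^ r * H n m := by
    intro n m p hn hm hp
    have := h.flatMap_replicate hp ((hApos hn).append (hApos hm))
    rw [List.flatMap_append, hAmul, hAmul, hF p hp] at this
    exact this
  have hHdiag : ∀ {k : ℕ}, 1 ≤ k → H k k = ((2 * k : ℕ) : ℝ) ^ r := by
    intro k hk
    simp only [hH, hA, List.replicate_append_replicate]
    rw [h.replicate_eq (by omega) (by positivity), hF _ (by omega), two_mul]
  set W : ℕ → ℝ × ℝ := fun k => w (A k) (A k)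
  have hW : ∀ {k}, 1 ≤ k → 0 < (W k).1 ∧ 0 < (W k).2 ∧ (W k).1 + (W k).2 = 1 := fun hk =>
    h.weights _ _ (hApos hk) (hApos hk)
  have hpart : ∀ {n m k : ℕ}, 1 ≤ n → 1 ≤ m → 1 ≤ k → g (H n m / ((2 * k : ℕ) : ℝ) ^ r) =
      (W k).1 * g ((n / k : ℝ) ^ r) + (W k).2 * g ((m / k : ℝ) ^ r) := by
    intro n m k hn hm hk
    have := h.partition (A n) (A m) (A k) (A k) (hApos hn) (hApos hm) (hApos hk) (hApos hk)
      (by rw [hAsum hn, hAsum hk]) (by rw [hAsum hm, hAsum hk])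
    rw [hFA hn, hFA hm, hFA hk, ← Real.div_rpow (by positivity) (by positivity),
      ← Real.div_rpow (by positivity) (by positivity)] at this
    rw [← hHdiag hk]
    exact this
  -- The triples `(2k, k; k)` and `(2, 1; 1)` give the same mean of `g (2 ^ r)` and `g 1`. These
  -- values differ because `r ≠ 0`, so the weights agree.
  have hWconst : ∀ {k}, 1 ≤ k → W k = W 1 := by
    intro k hk
    have hk' : (0 : ℝ) < k := by positivity
    have e1 := hpart (n := 2 * k) (m := 1 * k) (k := k) (by omega) (by omega) hk
    have e2 := hpart (n := 2) (m := 1) (k := 1) (by omega) le_rfl le_rfl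
    rw [hHmul (by omega) le_rfl hk] at e1
    push_cast at e1 e2
    rw [one_mul, div_self hk'.ne', mul_div_cancel_right₀ _ hk'.ne',
      Real.mul_rpow zero_le_two hk'.le, mul_comm, mul_div_mul_right _ _ (by positivity)] at e1
    rw [div_one, div_one] at e2
    rw [e2, Real.one_rpow] at e1
    have hne : g (2 ^ r) - g 1 ≠ 0 := by
      refine sub_ne_zero.2 fun e => ?_
      have e3 := h.generator_injective (mem_Ioi.2 (by positivity)) (mem_Ioi.2 one_pos) e
      have e4 := congrArg Real.log e3
      rw [Real.log_rpow two_pos, Real.log_one] at e4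
      exact mul_ne_zero hr (Real.log_pos one_lt_two).ne' e4
    obtain ⟨-, -, w1⟩ := hW hk
    obtain ⟨-, -, w2⟩ := hW le_rfl
    have h1 : (W k).1 = (W 1).1 := by
      refine mul_right_cancel₀ hne ?_
      linear_combination -e1 - g 1 * w1 + g 1 * w2
    exact Prod.ext h1 (by linarith)
  obtain ⟨w1, w2, w3⟩ := hW le_rfl
  have hPc : Continuous fun t => g (Real.exp (r * t)) :=
    h.generator_continuous.comp_continuous (by fun_prop) fun t => Real.exp_pos _
  have hPi : Function.Injective fun t => g (Real.exp (r * t)) := fun a b hab =>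
    mul_left_cancel₀ hr (Real.exp_injective
      (h.generator_injective (Real.exp_pos _) (Real.exp_pos _) hab))
  refine affine_or_exp_of_dense hPc hPi w1 w2 w3 ?_
  have hexp : ∀ {y : ℝ}, 0 < y → Real.exp (r * Real.log y) = y ^ r := fun hy => by
    rw [Real.rpow_def_of_pos hy, mul_comm]
  have hlog : ∀ {a b : ℝ}, 0 < a → 0 < b → Real.log a + Real.log b = Real.log (a * b) :=
    fun ha hb => (Real.log_mul ha.ne' hb.ne').symm
  intro n m k p q hn hm hk hp hq
  have hn' : (0 : ℝ) < n := by positivity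
  have hm' : (0 : ℝ) < m := by positivity
  have hk' : (0 : ℝ) < k := by positivity
  have hp' : (0 : ℝ) < p := by positivity
  have hq' : (0 : ℝ) < q := by positivity
  have hμ : 0 < H n m / ((2 * k : ℕ) : ℝ) ^ r := div_pos (hHpos hn hm) (by positivity)
  -- Chosen so that `exp (r μ)` is the fairness ratio. Translation by `log (p / q)` passes to the
  -- triple `(n p, m p; k q)`.
  refine ⟨Real.log ((H n m / ((2 * k : ℕ) : ℝ) ^ r) ^ (1 / r)), ?_, ?_⟩
  · rw [hexp (by positivity), hexp (by positivity), hexp (by positivity), ← Real.rpow_mul hμ.le,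
      one_div_mul_cancel hr, Real.rpow_one, hpart hn hm hk, hWconst hk]
  · rw [hlog (by positivity) (by positivity), hlog (by positivity) (by positivity),
      hlog (by positivity) (by positivity), hexp (by positivity), hexp (by positivity),
      hexp (by positivity), Real.mul_rpow (by positivity) (by positivity), ← Real.rpow_mul hμ.le,
      one_div_mul_cancel hr, Real.rpow_one]
    have := hpart (Nat.mul_pos hn hp) (Nat.mul_pos hm hp) (Nat.mul_pos hk hq)
    rw [hHmul hn hm hp, hWconst (Nat.mul_pos hk hq)] at this
    push_cast at this ⊢
    rw [div_mul_div_comm, div_mul_div_comm, ← this]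
    congr 1
    rw [Real.div_rpow hp'.le hq'.le, ← mul_assoc, Real.mul_rpow (by positivity) hq'.le]
    field_simp

theorem generator (h : ListFairness F g w) {r : ℝ} (hr : r ≠ 0)
    (hF : ∀ n : ℕ, 1 ≤ n → F (List.replicate n 1) = (n : ℝ) ^ r) :
    GeneratorEquiv g Real.log ∨ ∃ β : ℝ, β ≠ 0 ∧ GeneratorEquiv g (fun y => y ^ β) := by
  have hy : ∀ {y : ℝ}, 0 < y → Real.exp (r * (Real.log y / r)) = y := fun hy => by
    rw [mul_div_cancel₀ _ hr, Real.exp_log hy]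
  rcases h.generator_comp_exp hr hF with ⟨c, d, hc, hg⟩ | ⟨c, d, κ, hc, hκ, hg⟩
  · refine Or.inl ⟨c / r, d, div_ne_zero hc hr, fun y hy0 => ?_⟩
    rw [← hy hy0, hg, hy hy0]
    ring
  · refine Or.inr ⟨κ / r, div_ne_zero hκ hr, c, d, hc, fun y hy0 => ?_⟩
    have := hg (Real.log y / r)
    rw [hy hy0] at this
    rw [this]
    simp only [Real.rpow_def_of_pos hy0]
    ring_nf

end ListFairness

/-! ### Extension from integer allocations -/

/-- Continuous homogeneous functions which agree on positive integer allocations agree. -/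
theorem eqOn_alloc_of_natCast {n : ℕ} (hn : 1 ≤ n) {f h : (Fin n → ℝ) → ℝ}
    (hf : ContinuousOn f (Alloc n)) (hh : ContinuousOn h (Alloc n))
    (hf' : ∀ x ∈ Alloc n, ∀ t : ℝ, 0 < t → f x = f (t • x))
    (hh' : ∀ x ∈ Alloc n, ∀ t : ℝ, 0 < t → h x = h (t • x))
    (heq : ∀ v : Fin n → ℕ, (∀ i, 1 ≤ v i) → f (fun i => v i) = h (fun i => v i))
    {x : Fin n → ℝ} (hx : x ∈ Alloc n) : f x = h x := by
  -- The added `1` keeps the approximants positive where `x i = 0`.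
  set u : ℕ → Fin n → ℝ := fun j i => (j : ℝ)⁻¹ * ((⌊x i * j⌋₊ + 1 : ℕ) : ℝ) with hu
  have hlim : Tendsto u atTop (𝓝 x) := by
    rw [tendsto_pi_nhds]
    intro i
    have h1 : Tendsto (fun j : ℕ => (⌊x i * j⌋₊ : ℝ) / j) atTop (𝓝 (x i)) :=
      (tendsto_nat_floor_mul_div_atTop (hx.1 i)).comp tendsto_natCast_atTop_atTop
    have h2 := h1.add (tendsto_one_div_atTop_nhds_zero_nat (𝕜 := ℝ))
    rw [add_zero] at h2
    refine h2.congr fun j => ?_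
    simp only [hu]
    push_cast
    ring
  have hmem : ∀ᶠ j in atTop, u j ∈ Alloc n := by
    filter_upwards [eventually_ge_atTop 1] with j hj
    exact mem_alloc_of_pos hn fun i => by positivity
  have hlim' : Tendsto u atTop (𝓝[Alloc n] x) := tendsto_nhdsWithin_iff.2 ⟨hlim, hmem⟩
  refine tendsto_nhds_unique ((hf x hx).tendsto.comp hlim')
    (((hh x hx).tendsto.comp hlim').congr' ?_)
  filter_upwards [eventually_ge_atTop 1] with j hj
  have hj' : (0 : ℝ) < (j : ℝ)⁻¹ := by positivity
  have hv : (fun i => ((⌊x i * j⌋₊ + 1 : ℕ) : ℝ)) ∈ Alloc n :=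
    mem_alloc_of_pos hn fun i => by positivity
  have e : u j = (j : ℝ)⁻¹ • fun i => ((⌊x i * j⌋₊ + 1 : ℕ) : ℝ) := rfl
  simp only [Function.comp, e]
  rw [← hf' _ hv _ hj', ← hh' _ hv _ hj', heq _ fun i => by omega]

namespace FairnessAxioms

variable {f : (n : ℕ) → (Fin n → ℝ) → ℝ} {g : ℝ → ℝ} {s : WeightSystem}

/-- A fairness measure is determined by its values on lists of positive integers. -/
lemma eq_of_natCast (h : FairnessAxioms f g s) {n : ℕ} (hn : 1 ≤ n) {φ : (Fin n → ℝ) → ℝ}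
    (hφ : ContinuousOn φ (Alloc n)) (hφ' : ∀ x ∈ Alloc n, ∀ t : ℝ, 0 < t → φ x = φ (t • x))
    (heq : ∀ v : Fin n → ℕ, (∀ i, 1 ≤ v i) →
      onLists f ((List.ofFn v).map (↑)) = φ (fun i => v i))
    {x : Fin n → ℝ} (hx : x ∈ Alloc n) : f n x = f 1 (fun _ => 1) * φ x := by
  refine eqOn_alloc_of_natCast hn (h := fun x => f 1 (fun _ => 1) * φ x) (h.continuity n hn)
    (continuousOn_const.mul hφ) (h.homogeneity n hn) (fun y hy t ht => ?_) (fun v hv => ?_) hx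
  · simp only [← hφ' y hy t ht]
  · rw [← heq v hv, h.eq_sign_mul, List.map_ofFn]
    rfl

lemma eq_sign_of_replicate (h : FairnessAxioms f g s)
    (h1 : ∀ n : ℕ, 1 ≤ n → onLists f (List.replicate n 1) = 1) {n : ℕ} (hn : 1 ≤ n)
    {x : Fin n → ℝ} (hx : x ∈ Alloc n) : f n x = f 1 (fun _ => 1) := by
  rw [h.eq_of_natCast hn (φ := fun _ => 1) continuousOn_const (fun _ _ _ _ => rfl) ?_ hx, mul_one]
  intro v hv
  refine h.listFairness.eq_one_of_replicate h1 ?_ ?_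
  · rw [Ne, List.ofFn_eq_nil_iff]
    omega
  · rwa [List.forall_mem_ofFn_iff]

theorem generator (h : FairnessAxioms f g s)
    (hf : ¬ ∃ c : ℝ, ∀ n, 1 ≤ n → ∀ x ∈ Alloc n, f n x = c) :
    GeneratorEquiv g Real.log ∨ ∃ β : ℝ, β ≠ 0 ∧ GeneratorEquiv g (fun y => y ^ β) := by
  obtain ⟨r, hr⟩ := h.listFairness.exists_rpow
  refine h.listFairness.generator (r := r) (fun h0 => hf ⟨f 1 (fun _ => 1), ?_⟩) hr
  intro n hn x hx
  exact h.eq_sign_of_replicate (fun k hk => by rw [hr k hk, h0, Real.rpow_zero]) hn hx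

end FairnessAxioms

/-! ### Construction from power weights -/

/-- The equation reads `(2 ^ q - 1) * (3 ^ q - 1) = 2`. For `q > 0` the left side increases through
`2` at `q = 1`; for `q ≤ 0` the product `2 ^ q * 3 ^ q` is at most `1`, while the original right
side exceeds `1`. -/
lemma eq_one_of_rpow_two_three {q : ℝ} (h : (2 : ℝ) ^ q * 3 ^ q = 2 ^ q + 3 ^ q + 1) : q = 1 := by
  have h2 : (0 : ℝ) < 2 ^ q := by positivity
  have h3 : (0 : ℝ) < 3 ^ q := by positivity
  have r2 : (2 : ℝ) ^ (1 : ℝ) = 2 := Real.rpow_one 2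
  have r3 : (3 : ℝ) ^ (1 : ℝ) = 3 := Real.rpow_one 3
  rcases lt_trichotomy q 1 with hq | hq | hq
  · have u2 := Real.rpow_lt_rpow_of_exponent_lt (x := 2) one_lt_two hq
    have u3 := Real.rpow_lt_rpow_of_exponent_lt (x := 3) (by norm_num) hq
    rw [r2] at u2
    rw [r3] at u3
    rcases le_or_gt q 0 with hq0 | hq0
    · have v2 := Real.rpow_le_one_of_one_le_of_nonpos (x := (2 : ℝ)) one_le_two hq0
      have v3 := Real.rpow_le_one_of_one_le_of_nonpos (x := (3 : ℝ)) (by norm_num) hq0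
      nlinarith
    · have v2 := Real.one_lt_rpow (x := (2 : ℝ)) one_lt_two hq0
      have v3 := Real.one_lt_rpow (x := (3 : ℝ)) (by norm_num) hq0
      nlinarith
  · exact hq
  · have u2 := Real.rpow_lt_rpow_of_exponent_lt (x := 2) one_lt_two hq
    have u3 := Real.rpow_lt_rpow_of_exponent_lt (x := 3) (by norm_num) hq
    rw [r2] at u2
    rw [r3] at u3
    nlinarith

lemma posList_natCast {l : List ℕ} (hl : l ≠ []) (h : ∀ k ∈ l, 1 ≤ k) :
    PosList (l.map ((↑) : ℕ → ℝ)) := by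
  refine ⟨by simpa using hl, fun a ha => ?_⟩
  obtain ⟨k, hk, rfl⟩ := List.mem_map.1 ha
  have := h k hk
  positivity

/-- Composition of the values `E = f ^ β` on two blocks, for power weights. -/
def PowerMerge (E : List ℝ → ℝ) (ρ : ℝ) : Prop :=
  ∀ l₁ l₂, PosList l₁ → PosList l₂ → E (l₁ ++ l₂) =
    E [l₁.sum, l₂.sum] * ((l₁.sum ^ ρ * E l₁ + l₂.sum ^ ρ * E l₂) / (l₁.sum ^ ρ + l₂.sum ^ ρ))

/-- Composition of the values `L = log f` on two blocks, for power weights. -/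
def LogMerge (L : List ℝ → ℝ) (ρ : ℝ) : Prop :=
  ∀ l₁ l₂, PosList l₁ → PosList l₂ → L (l₁ ++ l₂) =
    L [l₁.sum, l₂.sum] + (l₁.sum ^ ρ * L l₁ + l₂.sum ^ ρ * L l₂) / (l₁.sum ^ ρ + l₂.sum ^ ρ)

/-- Merging `m` ones with `n` ones gives `m + n` ones, so the two-user value is the only unknown. -/
lemma PowerMerge.pair {E : List ℝ → ℝ} {ρ c : ℝ} (h : PowerMerge E ρ)
    (hE : ∀ n : ℕ, 1 ≤ n → E (List.replicate n 1) = (n : ℝ) ^ c) {m n : ℕ} (hm : 1 ≤ m)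
    (hn : 1 ≤ n) : E [(m : ℝ), (n : ℝ)] = ((m : ℝ) + n) ^ c *
      (((m : ℝ) ^ ρ + (n : ℝ) ^ ρ) / ((m : ℝ) ^ ρ * (m : ℝ) ^ c + (n : ℝ) ^ ρ * (n : ℝ) ^ c)) := by
  have key := h _ _ (posList_replicate hm one_pos) (posList_replicate hn one_pos)
  rw [List.replicate_append_replicate, hE _ (by omega), hE m hm, hE n hn] at key
  simp only [List.sum_replicate, nsmul_eq_mul, mul_one] at key
  push_cast at key
  have hm' : (0 : ℝ) < m := by positivity
  have hn' : (0 : ℝ) < n := by positivity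
  rw [key]
  field_simp

lemma PowerMerge.exponent {E : List ℝ → ℝ} {ρ c : ℝ} (h : PowerMerge E ρ)
    (hE : ∀ n : ℕ, 1 ≤ n → E (List.replicate n 1) = (n : ℝ) ^ c) (hE1 : ∀ a, 0 < a → E [a] = 1)
    (hc : c ≠ 0) : ρ + c = 1 := by
  have p1 : ∀ a : ℝ, 0 < a → PosList [a] := fun a ha => posList_single ha
  have e11 : E [1, 1] = 2 ^ c := by simpa using hE 2 (by norm_num)
  have e21 := h.pair hE (m := 2) (n := 1) (by norm_num) le_rfl
  have e31 := h.pair hE (m := 3) (n := 1) (by norm_num) le_rfl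
  have e22 := h.pair hE (m := 2) (n := 2) (by norm_num) (by norm_num)
  -- Associativity: `(2, 1, 1)` is bracketed as `(2, 1), 1` here and as `2, (1, 1)` in `m2`.
  have m1 := h ([2] ++ [1]) [1] ((p1 2 two_pos).append (p1 1 one_pos)) (p1 1 one_pos)
  have m2 := h [2] ([1] ++ [1]) (p1 2 two_pos) ((p1 1 one_pos).append (p1 1 one_pos))
  norm_num at e21 e31 e22 m1 m2
  have e4 : (4 : ℝ) ^ c = 2 ^ c * 2 ^ c := by
    rw [← Real.mul_rpow zero_le_two zero_le_two]
    norm_num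
  rw [m1, hE1 1 one_pos, e21, e31, e4] at m2
  rw [e22, hE1 2 two_pos, e11, e4] at m2
  have ha : (0 : ℝ) < 2 ^ ρ := by positivity
  have hb : (0 : ℝ) < 3 ^ ρ := by positivity
  have hd : (0 : ℝ) < 2 ^ c := by positivity
  have he : (0 : ℝ) < 3 ^ c := by positivity
  have hd1 : (2 : ℝ) ^ c - 1 ≠ 0 := by
    refine sub_ne_zero.2 fun h0 => ?_
    have e4 := congrArg Real.log h0
    rw [Real.log_rpow two_pos, Real.log_one] at e4
    exact mul_ne_zero hc (Real.log_pos one_lt_two).ne' e4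
  refine eq_one_of_rpow_two_three ?_
  rw [Real.rpow_add two_pos, Real.rpow_add three_pos]
  generalize (2 : ℝ) ^ ρ = a at *
  generalize (3 : ℝ) ^ ρ = b at *
  generalize (2 : ℝ) ^ c = d at *
  generalize (3 : ℝ) ^ c = e at *
  -- The difference of the two sides is `d - 1` times the required relation; `c ≠ 0` permits
  -- cancelling that factor.
  have m3 : (1 + d) * (b * e + 1) * (a * d + 1) = 2 * d * (b * e * (a + 1) + a * d + 1) := by
    field_simp at m2
    linarith
  refine mul_left_cancel₀ hd1 ?_
  linear_combination m3

/-- Entries are prepended one at a time. Since `ρ + c = 1`, each `a ^ ρ * a ^ c` is `a`, and the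
denominators of the merging rule cancel. -/
lemma PowerMerge.formula {E : List ℝ → ℝ} {ρ c : ℝ} (h : PowerMerge E ρ)
    (hE : ∀ n : ℕ, 1 ≤ n → E (List.replicate n 1) = (n : ℝ) ^ c) (hE1 : ∀ a, 0 < a → E [a] = 1)
    (hρ : ρ + c = 1) (l : List ℕ) (hl : l ≠ []) (hpos : ∀ k ∈ l, 1 ≤ k) :
    E (l.map (↑)) = (l.map fun k : ℕ => (k : ℝ) ^ ρ).sum / ((l.sum : ℕ) : ℝ) ^ ρ := by
  have hpow : ∀ {a : ℝ}, 0 < a → a ^ ρ * a ^ c = a := fun ha => by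
    rw [← Real.rpow_add ha, hρ, Real.rpow_one]
  induction l with
  | nil => exact absurd rfl hl
  | cons k l ih =>
    have hk := hpos k (by simp)
    have hk' : (0 : ℝ) < k := by positivity
    have hpos' : ∀ k ∈ l, 1 ≤ k := fun j hj => hpos j (List.mem_cons_of_mem k hj)
    rcases eq_or_ne l [] with rfl | hne
    · simp only [List.map_cons, List.map_nil, hE1 _ hk', List.sum_singleton]
      rw [div_self (by positivity)]
    · have hlp := posList_natCast hne hpos'
      have hs : 1 ≤ l.sum := by
        have := hlp.sum_pos
        rw [← Nat.cast_list_sum (R := ℝ)] at this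
        exact_mod_cast this
      have hs' : (0 : ℝ) < (l.sum : ℕ) := by positivity
      have key := h [(k : ℝ)] (l.map ((↑) : ℕ → ℝ)) (posList_single hk') hlp
      rw [ih hne hpos', ← Nat.cast_list_sum, List.sum_singleton, h.pair hE hk hs, hE1 _ hk', hpow hk',
        hpow hs'] at key
      rw [List.map_cons, ← List.singleton_append, key, List.map_cons, List.sum_cons, List.sum_cons]
      push_cast at hs' ⊢
      generalize (List.map (Nat.cast : ℕ → ℝ) l).sum = T at *
      have hkT := hpow (add_pos hk' hs')
      have : 0 < ((k : ℝ) + T) ^ ρ := by positivity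
      have : ((k : ℝ) + T) ^ c = (k + T) / (k + T) ^ ρ := by
        rw [eq_div_iff this.ne']
        linarith
      rw [this]
      field_simp

lemma LogMerge.pair {L : List ℝ → ℝ} {ρ r : ℝ} (h : LogMerge L ρ)
    (hL : ∀ n : ℕ, 1 ≤ n → L (List.replicate n 1) = r * Real.log n) {m n : ℕ} (hm : 1 ≤ m)
    (hn : 1 ≤ n) : L [(m : ℝ), (n : ℝ)] = r * (Real.log (m + n) -
      ((m : ℝ) ^ ρ * Real.log m + (n : ℝ) ^ ρ * Real.log n) / ((m : ℝ) ^ ρ + (n : ℝ) ^ ρ)) := by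
  have key := h _ _ (posList_replicate hm one_pos) (posList_replicate hn one_pos)
  rw [List.replicate_append_replicate, hL _ (by omega), hL m hm, hL n hn] at key
  simp only [List.sum_replicate, nsmul_eq_mul, mul_one] at key
  push_cast at key
  rw [mul_sub, key]
  ring

lemma LogMerge.exponent {L : List ℝ → ℝ} {ρ r : ℝ} (h : LogMerge L ρ)
    (hL : ∀ n : ℕ, 1 ≤ n → L (List.replicate n 1) = r * Real.log n)
    (hL1 : ∀ a, 0 < a → L [a] = 0) (hr : r ≠ 0) : ρ = 1 := by
  have p1 : ∀ a : ℝ, 0 < a → PosList [a] := fun a ha => posList_single ha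
  have e11 : L [1, 1] = r * Real.log 2 := by simpa using hL 2 (by norm_num)
  have e21 := h.pair hL (m := 2) (n := 1) (by norm_num) le_rfl
  have e31 := h.pair hL (m := 3) (n := 1) (by norm_num) le_rfl
  have e22 := h.pair hL (m := 2) (n := 2) (by norm_num) (by norm_num)
  have m1 := h ([2] ++ [1]) [1] ((p1 2 two_pos).append (p1 1 one_pos)) (p1 1 one_pos)
  have m2 := h [2] ([1] ++ [1]) (p1 2 two_pos) ((p1 1 one_pos).append (p1 1 one_pos))
  norm_num at e21 e31 e22 m1 m2
  have e4 : Real.log 4 = Real.log 2 + Real.log 2 := by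
    rw [← Real.log_mul two_ne_zero two_ne_zero]
    norm_num
  rw [m1, hL1 1 one_pos, e21, e31, e4] at m2
  rw [e22, hL1 2 two_pos, e11, e4] at m2
  have ha : (0 : ℝ) < 2 ^ ρ := by positivity
  have hb : (0 : ℝ) < 3 ^ ρ := by positivity
  have hl2 : Real.log 2 ≠ 0 := (Real.log_pos one_lt_two).ne'
  refine eq_one_of_rpow_two_three ?_
  generalize (2 : ℝ) ^ ρ = a at *
  generalize (3 : ℝ) ^ ρ = b at *
  refine mul_left_cancel₀ hl2 (mul_left_cancel₀ hr ?_)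
  field_simp at m2
  linear_combination -m2

lemma LogMerge.formula {L : List ℝ → ℝ} {r : ℝ} (h : LogMerge L 1)
    (hL : ∀ n : ℕ, 1 ≤ n → L (List.replicate n 1) = r * Real.log n) (hL1 : ∀ a, 0 < a → L [a] = 0)
    (l : List ℕ) (hl : l ≠ []) (hpos : ∀ k ∈ l, 1 ≤ k) :
    L (l.map (↑)) = r * (Real.log ((l.sum : ℕ) : ℝ) -
      (l.map fun k : ℕ => (k : ℝ) * Real.log k).sum / ((l.sum : ℕ) : ℝ)) := by
  induction l with
  | nil => exact absurd rfl hl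
  | cons k l ih =>
    have hk := hpos k (by simp)
    have hk' : (0 : ℝ) < k := by positivity
    have hpos' : ∀ k ∈ l, 1 ≤ k := fun j hj => hpos j (List.mem_cons_of_mem k hj)
    rcases eq_or_ne l [] with rfl | hne
    · simp only [List.map_cons, List.map_nil, hL1 _ hk', List.sum_singleton]
      rw [mul_div_cancel_left₀ _ hk'.ne', sub_self, mul_zero]
    · have hlp := posList_natCast hne hpos'
      have hs : 1 ≤ l.sum := by
        have := hlp.sum_pos
        rw [← Nat.cast_list_sum (R := ℝ)] at this
        exact_mod_cast this
      have hs' : (0 : ℝ) < (l.sum : ℕ) := by positivity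
      have key := h [(k : ℝ)] (l.map ((↑) : ℕ → ℝ)) (posList_single hk') hlp
      rw [ih hne hpos', ← Nat.cast_list_sum, List.sum_singleton, h.pair hL hk hs, hL1 _ hk'] at key
      simp only [Real.rpow_one] at key
      rw [List.map_cons, ← List.singleton_append, key, List.map_cons, List.sum_cons, List.sum_cons]
      push_cast at hs' ⊢
      generalize (List.map (Nat.cast : ℕ → ℝ) l).sum = T at *
      field_simp
      ring

/-! ### Fairness measures with power weights. -/

namespace FairnessAxioms

variable {f : (n : ℕ) → (Fin n → ℝ) → ℝ} {g : ℝ → ℝ} {s : WeightSystem}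

/-- The reference blocks are single users holding the block totals, whose normalized fairness is
`1`. The affine change from `g` to `φ` cancels because the weights sum to one. -/
lemma merge (h : FairnessAxioms f g s) {ρ : ℝ} (hs : HasPowerWeights s ρ) {φ : ℝ → ℝ}
    (hg : GeneratorEquiv g φ) {l₁ l₂ : List ℝ} (h₁ : PosList l₁) (h₂ : PosList l₂) :
    φ (onLists f (l₁ ++ l₂) / onLists f [l₁.sum, l₂.sum]) =
      (l₁.sum ^ ρ * φ (onLists f l₁) + l₂.sum ^ ρ * φ (onLists f l₂)) /
        (l₁.sum ^ ρ + l₂.sum ^ ρ) := by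
  obtain ⟨a, b, ha, hab⟩ := hg
  have t₁ := h₁.sum_pos
  have t₂ := h₂.sum_pos
  have hF := h.listFairness
  have key := hF.partition l₁ l₂ [l₁.sum] [l₂.sum] h₁ h₂ (posList_single t₁) (posList_single t₂)
    (by simp) (by simp)
  have hw : s.onLists [l₁.sum] [l₂.sum] = (l₁.sum ^ ρ / (l₁.sum ^ ρ + l₂.sum ^ ρ),
      l₂.sum ^ ρ / (l₁.sum ^ ρ + l₂.sum ^ ρ)) := by
    rw [← hs _ _ t₁ t₂, WeightSystem.onLists]
    congr 1 <;> ext i <;> simp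
  have hp := hF.pos _ ((posList_single t₁).append (posList_single t₂))
  rw [hw, hF.single _ t₁, hF.single _ t₂, div_one, div_one,
    hab _ (div_pos (hF.pos _ (h₁.append h₂)) hp), hab _ (hF.pos _ h₁), hab _ (hF.pos _ h₂)] at key
  rw [List.singleton_append] at key
  refine mul_left_cancel₀ ha ?_
  have : 0 < l₁.sum ^ ρ := by positivity
  have : 0 < l₂.sum ^ ρ := by positivity
  rw [← add_left_inj b, key]
  field_simp
  ring

lemma powerMerge (h : FairnessAxioms f g s) {ρ β : ℝ} (hs : HasPowerWeights s ρ)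
    (hg : GeneratorEquiv g (fun y => y ^ β)) : PowerMerge (fun l => onLists f l ^ β) ρ := by
  intro l₁ l₂ h₁ h₂
  have hp := h.onLists_pos ((posList_single h₁.sum_pos).append (posList_single h₂.sum_pos))
  have key := h.merge hs hg h₁ h₂
  simp only [] at key ⊢
  rw [List.singleton_append] at hp
  rw [Real.div_rpow (h.onLists_pos (h₁.append h₂)).le hp.le,
    div_eq_iff (Real.rpow_pos_of_pos hp β).ne'] at key
  rw [key, mul_comm]

lemma logMerge (h : FairnessAxioms f g s) {ρ : ℝ} (hs : HasPowerWeights s ρ)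
    (hg : GeneratorEquiv g Real.log) : LogMerge (fun l => Real.log (onLists f l)) ρ := by
  intro l₁ l₂ h₁ h₂
  have hp := h.onLists_pos ((posList_single h₁.sum_pos).append (posList_single h₂.sum_pos))
  have key := h.merge hs hg h₁ h₂
  rw [List.singleton_append] at hp
  rw [Real.log_div (h.onLists_pos (h₁.append h₂)).ne' hp.ne'] at key
  simp only [] at key ⊢
  rw [← key]
  ring

lemma starved_mem : ![(1 : ℝ), 0] ∈ Alloc 2 := by
  refine ⟨fun i => by fin_cases i <;> simp, fun h => ?_⟩
  simpa using congrFun h 0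

lemma half_mem : ![(1 : ℝ) / 2, 1 / 2] ∈ Alloc 2 :=
  mem_alloc_of_pos (by norm_num) fun i => by fin_cases i <;> simp

/-- The parameter changes sign because `logForm r` takes the value `n ^ (-r)` on equal allocations.
-/
theorem construction_log (h : FairnessAxioms f g s) {ρ : ℝ} (hs : HasPowerWeights s ρ)
    (hg : GeneratorEquiv g Real.log) {r : ℝ} (hr : r ≠ 0)
    (hF : ∀ n : ℕ, 1 ≤ n → onLists f (List.replicate n 1) = (n : ℝ) ^ r) :
    LogAdmissible (f 1 fun _ => 1) (-r) ∧
      (∀ n, 1 ≤ n → ∀ x ∈ Alloc n, f n x = f 1 (fun _ => 1) * logForm (-r) x) ∧ ρ = 1 := by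
  have hm := h.logMerge hs hg
  have hL : ∀ n : ℕ, 1 ≤ n → Real.log (onLists f (List.replicate n 1)) = r * Real.log n :=
    fun n hn => by rw [hF n hn, Real.log_rpow (by positivity)]
  have hL1 : ∀ a, 0 < a → Real.log (onLists f [a]) = 0 := fun a ha => by
    rw [h.listFairness.single a ha, Real.log_one]
  obtain rfl := hm.exponent hL hL1 hr
  have hval : ∀ n, 1 ≤ n → ∀ x ∈ Alloc n, f n x = f 1 (fun _ => 1) * logForm (-r) x := by
    intro n hn x hx
    refine h.eq_of_natCast hn (continuousOn_logForm (-r) n)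
      (fun y _ t ht => (logForm_smul _ y ht).symm) (fun v hv => ?_) hx
    have hne : List.ofFn v ≠ [] := by
      rw [Ne, List.ofFn_eq_nil_iff]
      omega
    have hv' : ∀ k ∈ List.ofFn v, 1 ≤ k := by rwa [List.forall_mem_ofFn_iff]
    have hva : (fun i => (v i : ℝ)) ∈ Alloc n := mem_alloc_of_pos hn fun i => by
      have := hv i
      positivity
    refine Real.log_injOn_pos (h.onLists_pos (posList_natCast hne hv')) (logForm_pos _ hva) ?_
    rw [log_logForm _ hva, hm.formula hL hL1 _ hne hv', List.map_ofFn, List.sum_ofFn, List.sum_ofFn]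
    push_cast
    simp only [Function.comp]
    ring
  refine ⟨⟨h.sign, ?_⟩, hval, rfl⟩
  rw [logAdmissible_increasing_iff h.sign, ← hval 2 (by norm_num) _ starved_mem,
    ← hval 2 (by norm_num) _ half_mem]
  exact h.increasing

/-- If `ρ < 0 < β`, the value at `(k, 1)` is at least `(k + 1) ^ (-ρ / β)`, which is unbounded,
although `(k, 1) / k` tends to the allocation `(1, 0)`, where `f` is continuous. -/
lemma exponent_nonneg_or_neg (h : FairnessAxioms f g s) {ρ β : ℝ}
    (hval : ∀ k : ℕ, 1 ≤ k →
      onLists f [(k : ℝ), 1] = (((k : ℝ) ^ ρ + 1) / ((k : ℝ) + 1) ^ ρ) ^ (1 / β)) (hβ : β ≠ 0) :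
    0 ≤ ρ ∨ β < 0 := by
  by_contra! hcon
  obtain ⟨hρ, hβ'⟩ := hcon
  have hβ' : 0 < β := hβ'.lt_of_ne' hβ
  set u : ℕ → Fin 2 → ℝ := fun k => (k : ℝ)⁻¹ • ![(k : ℝ), 1] with hu
  have hlim : Tendsto u atTop (𝓝 ![1, 0]) := by
    rw [tendsto_pi_nhds]
    intro i
    fin_cases i
    · refine tendsto_const_nhds.congr' ?_
      filter_upwards [eventually_ge_atTop 1] with k hk
      have : (k : ℝ) ≠ 0 := by positivity
      simp [hu, this]
    · simpa [hu] using tendsto_inv_atTop_nhds_zero_nat (𝕜 := ℝ)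
  have hpos : ∀ k : ℕ, 1 ≤ k → ∀ i, 0 < ![(k : ℝ), 1] i := by
    intro k hk i
    have : (0 : ℝ) < k := by positivity
    fin_cases i <;> simp [this]
  have hmem : ∀ᶠ k in atTop, u k ∈ Alloc 2 := by
    filter_upwards [eventually_ge_atTop 1] with k hk
    exact mem_alloc_of_pos (by norm_num) fun i => mul_pos (by positivity) (hpos k hk i)
  have hcont := (h.continuity 2 (by norm_num) _ starved_mem).tendsto.comp
    (tendsto_nhdsWithin_iff.2 ⟨hlim, hmem⟩)
  have hcont' := hcont.const_mul (f 1 fun _ => 1)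
  have hexp : 0 < -ρ * (1 / β) := mul_pos (by linarith) (by positivity)
  have hinf : Tendsto (fun k : ℕ => ((k : ℝ) + 1) ^ (-ρ * (1 / β))) atTop atTop :=
    (tendsto_rpow_atTop hexp).comp (tendsto_natCast_atTop_atTop.atTop_add tendsto_const_nhds)
  refine not_tendsto_nhds_of_tendsto_atTop (tendsto_atTop_mono' _ ?_ hinf) _ hcont'
  filter_upwards [eventually_ge_atTop 1] with k hk
  have hk' : (0 : ℝ) < k := by positivity
  have e : f 1 (fun _ => 1) * f 2 (u k) = onLists f [(k : ℝ), 1] := by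
    rw [hu, ← h.homogeneity 2 (by norm_num) _ (mem_alloc_of_pos (by norm_num) (hpos k hk)) _
      (by positivity), h.eq_sign_mul ![(k : ℝ), 1], ← mul_assoc, h.sign_mul_self, one_mul]
    simp
  simp only [Function.comp]
  rw [e, hval k hk, Real.rpow_mul (by positivity)]
  refine Real.rpow_le_rpow (by positivity) ?_ (by positivity)
  rw [Real.rpow_neg (by positivity), ← one_div]
  have : 0 < (k : ℝ) ^ ρ := by positivity
  gcongr
  linarith

theorem construction_power (h : FairnessAxioms f g s) {ρ β : ℝ} (hs : HasPowerWeights s ρ)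
    (hβ : β ≠ 0) (hg : GeneratorEquiv g (fun y => y ^ β)) {r : ℝ} (hr : r ≠ 0)
    (hF : ∀ n : ℕ, 1 ≤ n → onLists f (List.replicate n 1) = (n : ℝ) ^ r) :
    PowerAdmissible (f 1 fun _ => 1) β r ∧
      (∀ n, 1 ≤ n → ∀ x ∈ Alloc n, f n x = f 1 (fun _ => 1) * powerForm β r x) ∧
      ρ = 1 - β * r := by
  have hm := h.powerMerge hs hg
  have hE : ∀ n : ℕ, 1 ≤ n → onLists f (List.replicate n 1) ^ β = (n : ℝ) ^ (β * r) :=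
    fun n hn => by rw [hF n hn, ← Real.rpow_mul (by positivity), mul_comm]
  have hE1 : ∀ a, 0 < a → onLists f [a] ^ β = 1 := fun a ha => by
    rw [h.listFairness.single a ha, Real.one_rpow]
  have hρ' := hm.exponent hE hE1 (mul_ne_zero hβ hr)
  have hρ : ρ = 1 - β * r := by linarith
  have hlist : ∀ l : List ℕ, l ≠ [] → (∀ k ∈ l, 1 ≤ k) → onLists f (l.map (↑)) =
      ((l.map fun k : ℕ => (k : ℝ) ^ ρ).sum / ((l.sum : ℕ) : ℝ) ^ ρ) ^ (1 / β) := by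
    intro l hl hpos
    rw [← hm.formula hE hE1 hρ' l hl hpos,
      ← Real.rpow_mul (h.onLists_pos (posList_natCast hl hpos)).le, mul_one_div_cancel hβ,
      Real.rpow_one]
  have hadm : 0 ≤ ρ ∨ β < 0 := by
    refine h.exponent_nonneg_or_neg (fun k hk => ?_) hβ
    have := hlist [k, 1] (by simp) (by simpa using hk)
    simpa using this
  have hadm' : 0 ≤ 1 - β * r ∨ β < 0 := hρ ▸ hadm
  have hval : ∀ n, 1 ≤ n → ∀ x ∈ Alloc n, f n x = f 1 (fun _ => 1) * powerForm β r x := by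
    intro n hn x hx
    refine h.eq_of_natCast hn (continuousOn_powerForm hadm' n)
      (fun y _ t ht => (powerForm_smul _ _ y ht).symm) (fun v hv => ?_) hx
    have hne : List.ofFn v ≠ [] := by
      rw [Ne, List.ofFn_eq_nil_iff]
      omega
    have hvp : ∀ i, 0 < (v i : ℝ) := fun i => by
      have := hv i
      positivity
    rw [hlist _ hne (by rwa [List.forall_mem_ofFn_iff]), powerForm_of_pos β r hvp,
      sum_share_rpow _ (mem_alloc_of_pos hn hvp), List.map_ofFn, List.sum_ofFn, List.sum_ofFn, hρ]
    push_cast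
    rfl
  refine ⟨⟨h.sign, hβ, hadm', ?_⟩, hval, hρ⟩
  rw [powerAdmissible_increasing_iff h.sign hβ hadm', ← hval 2 (by norm_num) _ starved_mem,
    ← hval 2 (by norm_num) _ half_mem]
  exact h.increasing

theorem construction (h : FairnessAxioms f g s) {ρ : ℝ} (hs : HasPowerWeights s ρ) :
    (∃ σ r : ℝ, LogAdmissible σ r ∧
      (∀ n, 1 ≤ n → ∀ x ∈ Alloc n, f n x = σ * logForm r x) ∧
      (r ≠ 0 → GeneratorEquiv g Real.log ∧ ρ = 1)) ∨
    (∃ σ β r : ℝ, PowerAdmissible σ β r ∧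
      (∀ n, 1 ≤ n → ∀ x ∈ Alloc n, f n x = σ * powerForm β r x) ∧
      (r ≠ 0 → GeneratorEquiv g (fun y => y ^ β) ∧ ρ = 1 - β * r)) := by
  obtain ⟨r, hF⟩ := h.listFairness.exists_rpow
  by_cases hr : r = 0
  -- Here `f` is a constant sign, the logarithmic form with parameter `0`; nothing is claimed about
  -- `g` or `ρ`.
  · refine Or.inl ⟨_, 0, ⟨h.sign, by simp⟩, fun n hn x hx => ?_, fun h0 => absurd rfl h0⟩
    rw [h.eq_sign_of_replicate (fun k hk => by rw [hF k hk, hr, Real.rpow_zero]) hn hx]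
    simp [logForm]
  · rcases h.listFairness.generator hr hF with hg | ⟨β, hβ, hg⟩
    · obtain ⟨h1, h2, h3⟩ := h.construction_log hs hg hr hF
      exact Or.inl ⟨_, _, h1, h2, fun _ => ⟨hg, h3⟩⟩
    · obtain ⟨h1, h2, h3⟩ := h.construction_power hs hβ hg hr hF
      exact Or.inr ⟨_, β, r, h1, h2, fun _ => ⟨hg, h3⟩⟩

end FairnessAxioms

theorem mainTheorem4 :
    -- Existence
    (∃ f : (n : ℕ) → (Fin n → ℝ) → ℝ, IsFairnessMeasure f) ∧
    -- Existence, for each of the forms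
    (∀ σ r : ℝ, LogAdmissible σ r →
      ∃ s : WeightSystem, HasPowerWeights s 1 ∧
        FairnessAxioms (fun _ x => σ * logForm r x) Real.log s) ∧
    (∀ σ β r : ℝ, PowerAdmissible σ β r →
      ∃ s : WeightSystem, HasPowerWeights s (1 - β * r) ∧
        FairnessAxioms (fun _ x => σ * powerForm β r x) (fun y => y ^ β) s) ∧
    -- Uniqueness of the generator, for arbitrary weights
    (∀ (f : (n : ℕ) → (Fin n → ℝ) → ℝ) (g : ℝ → ℝ) (s : WeightSystem),
      FairnessAxioms f g s →
      (¬ ∃ c : ℝ, ∀ n, 1 ≤ n → ∀ x ∈ Alloc n, f n x = c) →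
      GeneratorEquiv g Real.log ∨ ∃ β : ℝ, β ≠ 0 ∧ GeneratorEquiv g (fun y => y ^ β)) ∧
    -- Construction of all fairness measures with power weights
    (∀ (f : (n : ℕ) → (Fin n → ℝ) → ℝ) (g : ℝ → ℝ) (s : WeightSystem) (ρ : ℝ),
      FairnessAxioms f g s → HasPowerWeights s ρ →
      (∃ σ r : ℝ, LogAdmissible σ r ∧
        (∀ n, 1 ≤ n → ∀ x ∈ Alloc n, f n x = σ * logForm r x) ∧
        (r ≠ 0 → GeneratorEquiv g Real.log ∧ ρ = 1)) ∨
      (∃ σ β r : ℝ, PowerAdmissible σ β r ∧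
        (∀ n, 1 ≤ n → ∀ x ∈ Alloc n, f n x = σ * powerForm β r x) ∧
        (r ≠ 0 → GeneratorEquiv g (fun y => y ^ β) ∧ ρ = 1 - β * r))) ∧
    -- Relation to the Atkinson index
    (∀ β r : ℝ, β ≠ 0 → β * r ≠ 1 → ∀ n : ℕ, 1 ≤ n → ∀ x : Fin n → ℝ, (∀ i, 0 < x i) →
      powerForm β r x = (n : ℝ) ^ r * (1 - atkinsonIndex (β * r) x) ^ ((1 - β * r) / β)) :=
  ⟨exists_isFairnessMeasure, fun _ _ => fairnessAxioms_logForm,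
    fun _ _ _ => fairnessAxioms_powerForm, fun _ _ _ h hf => h.generator hf,
    fun _ _ _ _ h hs => h.construction hs,
    fun _ _ hβ hr _ hn _ hx => powerForm_eq_atkinson hβ hr hn hx⟩
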